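/- Let $k$ be a $\mathbb Z$-graded commutative ring ($ab=(-1)^{|a||b|}ba$) and let $l$ be a $\mathbb Z$-graded, not necessarily commutative, ring. Let $\mathrm{Alg}_k$ be the category of graded commutative unital $k$-algebras, $\mathrm{Pro}\text{-}\mathrm{Alg}_k$ its pro-category, and $\mathrm{Mod}_l$ the category of graded right $l$-modules. A \emph{formal scheme} over $k$ is a functor from $\mathrm{Alg}_k$ to graded sets that is ind-representable, i.e. in each degree $q$ a small filtered colimit of representable functors; equivalently it is $\mathrm{Spf}(A)\colon R\mapsto \big(\mathrm{Pro}\text{-}\mathrm{Alg}_k(A^q,R)\big)_{q\in\mathbb Z}$ for a family $A=(A^q)_{q\in\mathbb Z}$ of pro-algebras. A \emph{formal $l$-module scheme} over $k$ is a functor $\mathrm{Alg}_k\to\mathrm{Mod}_l$ whose underlying functor to graded sets is a formal scheme. With natural transformations as morphisms these form categories $\mathrm{Sch}_k$ and $\mathrm{fModSch}_k^l$. Similarly, $\mathrm{fModSch}_k^{\mathbb Z}$ denotes the category of functors from $\mathrm{Alg}_k$ to graded abelian groups whose underlying functor to graded sets is a formal scheme (commutative formal group schemes). (1) The forgetful functor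 from cocommutative Hopf pro-algebras over $k$ (commutative cogroup objects in $\mathrm{Pro}\text{-}\mathrm{Alg}_k$, whose finite coproducts are tensor products over $k$) to $\mathrm{Pro}\text{-}\mathrm{Alg}_k$ has a right adjoint $\Gamma$ (the cofree cocommutative Hopf pro-algebra). The forgetful functor $V\colon\mathrm{fModSch}_k^{\mathbb Z}\to\mathrm{Sch}_k$ has a left adjoint $\mathrm{Fr}$, and $\mathrm{Fr}(\mathrm{Spf}(A))\cong\mathrm{Spf}(\Gamma(A))$ naturally in $A$ (with $\Gamma$ applied in each degree $q$), under which the unit $\mathrm{Spf}(A)\to V\,\mathrm{Fr}(\mathrm{Spf}(A))$ corresponds to $\mathrm{Spf}$ of the counit $\Gamma(A)\to A$. (2) The restriction functor $\mathrm{fModSch}_k^l\to\mathrm{fModSch}_k^{\mathbb Z}$ has a left adjoint $T$ (extension of scalars). The forgetful functor $V_l\colon\mathrm{fModSch}_k^l\to\mathrm{Sch}_k$ has a left adjoint $\mathrm{Fr}_l$, and $\mathrm{Fr}_l\cong T\circ\mathrm{Fr}$. (3) Let $\mathfrak F$ be the category of all functors $\mathrm{Alg}_k\to\mathrm{Mod}_l$.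 For $F\in\mathrm{Sch}_k$ let $\mathrm{Fr}_l\circ F\in\mathfrak F$ be the functor sending $R$ to the free graded $l$-module on the graded set $F(R)$, and let $c_F\colon\mathrm{Fr}_l\circ F\to\mathrm{Fr}_l(F)$ be the natural transformation that extends the unit $F\to V_l\,\mathrm{Fr}_l(F)$. Then for all $F\in\mathrm{Sch}_k$ and $G\in\mathrm{fModSch}_k^l$, composition with $c_F$ is a bijection \[ \mathrm{fModSch}_k^l(\mathrm{Fr}_l(F),G)\;\cong\;\mathfrak F(\mathrm{Fr}_l\circ F,G). \] (4) $V$ and $V_l$ are monadic: the comparison functors from $\mathrm{fModSch}_k^{\mathbb Z}$ and $\mathrm{fModSch}_k^l$ to the categories of algebras for the monads on $\mathrm{Sch}_k$ induced by $\mathrm{Fr}$ and $\mathrm{Fr}_l$ are equivalences. (5) The categories $\mathrm{fModSch}_k^{\mathbb Z}$ and $\mathrm{fModSch}_k^l$ have all small limits and all small colimits. -/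

import Mathlib

open CategoryTheory Limits Opposite

universe u

/-- A `ℤ`-graded (associative, unital, not necessarily commutative) ring, given by its family of
homogeneous components. The product is additive in both variables, and that of elements of degrees `i` and `j` lies in degree `n` whenever
`i + j = n`. -/
structure GrRing : Type (u + 1) where
  carrier : ℤ → Type u
  [addCommGroup : ∀ i, AddCommGroup (carrier i)]
  one : carrier 0
  mul : ∀ {i j n : ℤ}, i + j = n → carrier i →+ carrier j →+ carrier n
  one_mul : ∀ {i : ℤ} (h : 0 + i = i) (a : carrier i), mul h one a = a
  mul_one : ∀ {i : ℤ} (h : i + 0 = i) (a : carrier i), mul h a one = a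
  mul_assoc : ∀ {i j m ij jm n : ℤ} (hij : i + j = ij) (hn : ij + m = n) (hjm : j + m = jm)
    (hn' : i + jm = n) (a : carrier i) (b : carrier j) (c : carrier m),
    mul hn (mul hij a b) c = mul hn' a (mul hjm b c)

attribute [instance] GrRing.addCommGroup

/-- A graded commutative ring: a `ℤ`-graded ring with `a * b = (-1) ^ (i * j) b * a` for `a` of
degree `i` and `b` of degree `j`. -/
structure GrCommRing : Type (u + 1) extends GrRing.{u} where
  mul_comm : ∀ {i j n : ℤ} (h : i + j = n) (h' : j + i = n) (a : carrier i) (b : carrier j),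
    mul h a b = (i * j).negOnePow • mul h' b a

namespace GrCommRing

/-- Homomorphisms of graded rings: additive in each degree, unital and multiplicative. -/
@[ext]
structure Hom (A B : GrCommRing.{u}) where
  app : ∀ i : ℤ, A.carrier i →+ B.carrier i
  map_one : app 0 A.one = B.one
  map_mul : ∀ {i j n : ℤ} (h : i + j = n) (a : A.carrier i) (b : A.carrier j),
    app n (A.mul h a b) = B.mul h (app i a) (app j b)

instance : Category GrCommRing.{u} where
  Hom := Hom
  id A := ⟨fun _ => AddMonoidHom.id _, rfl, fun _ _ _ => rfl⟩
  comp f g := ⟨fun i => (g.app i).comp (f.app i), by simp [f.map_one, g.map_one],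
    fun h a b => by simp [f.map_mul, g.map_mul]⟩

@[ext]
theorem hom_ext {A B : GrCommRing.{u}} {f g : A ⟶ B} (h : ∀ i x, f.app i x = g.app i x) :
    f = g :=
  Hom.ext (funext fun i => AddMonoidHom.ext (h i))

theorem comp_app {A B C : GrCommRing.{u}} (f : A ⟶ B) (g : B ⟶ C) (i : ℤ) (x : A.carrier i) :
    (f ≫ g).app i x = g.app i (f.app i x) := rfl

/-! Colimits of graded commutative rings, by generators and relations. They are needed only to
know that graded commutative `k`-algebras have finite coproducts (their tensor products). -/
namespace Colim

variable {J : Type u} [SmallCategory J] (F : J ⥤ GrCommRing.{u})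

/-- Formal graded ring expressions in the elements of the rings `F j`. -/
inductive Pre : ℤ → Type u
  | of (j : J) (i : ℤ) (x : (F.obj j).carrier i) : Pre i
  | zero (i : ℤ) : Pre i
  | one : Pre 0
  | neg {i : ℤ} (a : Pre i) : Pre i
  | add {i : ℤ} (a b : Pre i) : Pre i
  | mul {i j n : ℤ} (h : i + j = n) (a : Pre i) (b : Pre j) : Pre n

/-- The relations that hold between expressions in every cocone over `F`. -/
inductive Rel : ∀ {i : ℤ}, Pre F i → Pre F i → Prop
  | refl {i} (a : Pre F i) : Rel a a
  | symm {i} {a b : Pre F i} : Rel a b → Rel b a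
  | trans {i} {a b c : Pre F i} : Rel a b → Rel b c → Rel a c
  | map {j j'} (f : j ⟶ j') (i) (x : (F.obj j).carrier i) :
      Rel (.of j' i ((F.map f).app i x)) (.of j i x)
  | of_one (j) : Rel (.of j 0 (F.obj j).one) .one
  | of_add (j i) (x y : (F.obj j).carrier i) : Rel (.of j i (x + y)) (.add (.of j i x) (.of j i y))
  | of_mul (j) {a b n : ℤ} (h : a + b = n) (x : (F.obj j).carrier a) (y : (F.obj j).carrier b) :
      Rel (.of j n ((F.obj j).mul h x y)) (.mul h (.of j a x) (.of j b y))
  | neg_congr {i} {a b : Pre F i} : Rel a b → Rel (.neg a) (.neg b)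
  | add_congr {i} {a b c d : Pre F i} : Rel a b → Rel c d → Rel (.add a c) (.add b d)
  | mul_congr {i j n} (h : i + j = n) {a b : Pre F i} {c d : Pre F j} :
      Rel a b → Rel c d → Rel (.mul h a c) (.mul h b d)
  | add_assoc {i} (a b c : Pre F i) : Rel (.add (.add a b) c) (.add a (.add b c))
  | add_comm {i} (a b : Pre F i) : Rel (.add a b) (.add b a)
  | zero_add {i} (a : Pre F i) : Rel (.add (.zero i) a) a
  | neg_add {i} (a : Pre F i) : Rel (.add (.neg a) a) (.zero i)
  | add_mul {i j n} (h : i + j = n) (a b : Pre F i) (c : Pre F j) :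
      Rel (.mul h (.add a b) c) (.add (.mul h a c) (.mul h b c))
  | mul_add {i j n} (h : i + j = n) (a : Pre F i) (b c : Pre F j) :
      Rel (.mul h a (.add b c)) (.add (.mul h a b) (.mul h a c))
  | one_mul {i} (h : 0 + i = i) (a : Pre F i) : Rel (.mul h .one a) a
  | mul_one {i} (h : i + 0 = i) (a : Pre F i) : Rel (.mul h a .one) a
  | mul_assoc {i j m ij jm n : ℤ} (hij : i + j = ij) (hn : ij + m = n) (hjm : j + m = jm)
      (hn' : i + jm = n) (a : Pre F i) (b : Pre F j) (c : Pre F m) :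
      Rel (.mul hn (.mul hij a b) c) (.mul hn' a (.mul hjm b c))
  | mul_comm_even {i j n : ℤ} (e : Even (i * j)) (h : i + j = n) (h' : j + i = n) (a : Pre F i)
      (b : Pre F j) : Rel (.mul h a b) (.mul h' b a)
  | mul_comm_odd {i j n : ℤ} (e : Odd (i * j)) (h : i + j = n) (h' : j + i = n) (a : Pre F i)
      (b : Pre F j) : Rel (.mul h a b) (.neg (.mul h' b a))

instance setoid (i : ℤ) : Setoid (Pre F i) := ⟨Rel F, Rel.refl, Rel.symm, Rel.trans⟩

instance (i : ℤ) : Add (Quotient (setoid F i)) :=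
  ⟨Quotient.map₂ Pre.add fun _ _ h _ _ h' => .add_congr h h'⟩

instance (i : ℤ) : Zero (Quotient (setoid F i)) := ⟨⟦.zero i⟧⟩

instance (i : ℤ) : Neg (Quotient (setoid F i)) :=
  ⟨Quotient.map Pre.neg fun _ _ h => .neg_congr h⟩

instance (i : ℤ) : AddCommGroup (Quotient (setoid F i)) where
  nsmul := nsmulRec
  zsmul := zsmulRec
  add_assoc := by rintro ⟨a⟩ ⟨b⟩ ⟨c⟩; exact Quotient.sound (.add_assoc a b c)
  add_comm := by rintro ⟨a⟩ ⟨b⟩; exact Quotient.sound (.add_comm a b)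
  zero_add := by rintro ⟨a⟩; exact Quotient.sound (.zero_add a)
  add_zero := by rintro ⟨a⟩; exact Quotient.sound ((Rel.add_comm _ _).trans (.zero_add a))
  neg_add_cancel := by rintro ⟨a⟩; exact Quotient.sound (.neg_add a)

/-- The colimit ring. -/
def pt : GrCommRing.{u} where
  carrier i := Quotient (setoid F i)
  one := ⟦.one⟧
  mul h := AddMonoidHom.mk' (fun x => AddMonoidHom.mk' (fun y =>
      Quotient.map₂ (Pre.mul h) (fun _ _ h₁ _ _ h₂ => .mul_congr h h₁ h₂) x y)
      (by rintro ⟨b⟩ ⟨c⟩; induction x using Quotient.inductionOn with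
          | _ a => exact Quotient.sound (.mul_add h a b c)))
      (by rintro ⟨a⟩ ⟨b⟩; ext ⟨c⟩; exact Quotient.sound (.add_mul h a b c))
  one_mul h := by rintro ⟨a⟩; exact Quotient.sound (.one_mul h a)
  mul_one h := by rintro ⟨a⟩; exact Quotient.sound (.mul_one h a)
  mul_assoc hij hn hjm hn' := by
    rintro ⟨a⟩ ⟨b⟩ ⟨c⟩; exact Quotient.sound (.mul_assoc hij hn hjm hn' a b c)
  mul_comm {i j n} h h' := by
    rintro ⟨a⟩ ⟨b⟩
    rcases Int.even_or_odd (i * j) with e | e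
    · rw [Int.negOnePow_even _ e, one_smul]; exact Quotient.sound (.mul_comm_even e h h' a b)
    · rw [Int.negOnePow_odd _ e, Units.neg_smul, one_smul]
      exact Quotient.sound (.mul_comm_odd e h h' a b)

/-- The colimit cocone. -/
def cocone : Cocone F where
  pt := pt F
  ι :=
    { app j :=
        { app i := AddMonoidHom.mk' (fun x => ⟦.of j i x⟧)
            fun x y => Quotient.sound (.of_add j i x y)
          map_one := Quotient.sound (.of_one j)
          map_mul h a b := Quotient.sound (.of_mul j h a b) }
      naturality _ _ f := hom_ext fun i x => Quotient.sound (.map f i x) }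

variable {F} (s : Cocone F)

/-- Evaluation of expressions in a cocone. -/
def eval : ∀ {i : ℤ}, Pre F i → s.pt.carrier i
  | _, .of j i x => (s.ι.app j).app i x
  | _, .zero _ => 0
  | _, .one => s.pt.one
  | _, .neg a => -eval a
  | _, .add a b => eval a + eval b
  | _, .mul h a b => s.pt.mul h (eval a) (eval b)

theorem eval_rel {i : ℤ} {a b : Pre F i} (r : Rel F a b) : eval s a = eval s b := by
  induction r with
  | refl => rfl
  | symm _ ih => exact ih.symm
  | trans _ _ ih₁ ih₂ => exact ih₁.trans ih₂
  | map f i x => exact congrArg (fun g : Hom _ _ => g.app i x) (s.w f)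
  | of_one j => exact (s.ι.app j).map_one
  | of_add j i x y => exact map_add _ x y
  | of_mul j h x y => exact (s.ι.app j).map_mul h x y
  | neg_congr _ ih => simp only [eval, ih]
  | add_congr _ _ ih₁ ih₂ => simp only [eval, ih₁, ih₂]
  | mul_congr h _ _ ih₁ ih₂ => simp only [eval, ih₁, ih₂]
  | add_assoc a b c => exact add_assoc _ _ _
  | add_comm a b => exact add_comm _ _
  | zero_add a => exact zero_add _
  | neg_add a => exact neg_add_cancel _
  | add_mul h a b c => simp [eval]
  | mul_add h a b c => simp [eval]
  | one_mul h a => exact s.pt.one_mul h _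
  | mul_one h a => exact s.pt.mul_one h _
  | mul_assoc hij hn hjm hn' a b c => exact s.pt.mul_assoc hij hn hjm hn' _ _ _
  | mul_comm_even e h h' a b =>
    simp only [eval]; rw [s.pt.mul_comm h h', Int.negOnePow_even _ e, one_smul]
  | mul_comm_odd e h h' a b =>
    simp only [eval]; rw [s.pt.mul_comm h h', Int.negOnePow_odd _ e, Units.neg_smul, one_smul]

/-- The colimit cocone is a colimit. -/
def isColimit : IsColimit (cocone F) where
  desc s :=
    { app i := AddMonoidHom.mk' (Quotient.lift (eval s) fun _ _ r => eval_rel s r)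
        (by rintro ⟨a⟩ ⟨b⟩; rfl)
      map_one := rfl
      map_mul h := by rintro ⟨a⟩ ⟨b⟩; rfl }
  fac s j := rfl
  uniq s m hm := by
    refine hom_ext fun i x => ?_
    induction x using Quotient.inductionOn with
    | _ a =>
      induction a with
      | of j i x => exact congrArg (fun g : Hom _ _ => g.app i x) (hm j)
      | zero i => exact map_zero (m.app i)
      | one => exact m.map_one
      | neg a ih => exact (map_neg (m.app _) _).trans (congrArg Neg.neg ih)
      | add a b iha ihb => exact (map_add (m.app _) _ _).trans (congrArg₂ (· + ·) iha ihb)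
      | mul h a b iha ihb =>
        exact (m.map_mul h _ _).trans (congrArg₂ (fun x y => s.pt.mul h x y) iha ihb)

end Colim

instance : HasColimits GrCommRing.{u} where
  has_colimits_of_shape _ _ := ⟨fun F => ⟨⟨⟨_, Colim.isColimit (F := F)⟩⟩⟩⟩

end GrCommRing

/-- The category of graded commutative (unital) `k`-algebras: graded commutative rings `R` with a
homomorphism `k ⟶ R`. -/
abbrev GrAlg (k : GrCommRing.{u}) : Type (u + 1) := Under k

/-- A graded right module over a graded ring `l`, given by its family of homogeneous components. -/
structure GrMod (l : GrRing.{u}) : Type (u + 1) where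
  carrier : ℤ → Type u
  [addCommGroup : ∀ i, AddCommGroup (carrier i)]
  /-- The right action `x ↦ a ↦ x a`. -/
  act : ∀ {i j n : ℤ}, i + j = n → carrier i →+ l.carrier j →+ carrier n
  act_one : ∀ {i : ℤ} (h : i + 0 = i) (x : carrier i), act h x l.one = x
  act_mul : ∀ {i j m ij jm n : ℤ} (hij : i + j = ij) (hn : ij + m = n) (hjm : j + m = jm)
    (hn' : i + jm = n) (x : carrier i) (a : l.carrier j) (b : l.carrier m),
    act hn (act hij x a) b = act hn' x (l.mul hjm a b)

attribute [instance] GrMod.addCommGroup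

namespace GrMod

variable (l : GrRing.{u})

variable {l} in
/-- Homomorphisms of graded modules (of degree zero). -/
@[ext]
structure Hom (M N : GrMod l) where
  app : ∀ i : ℤ, M.carrier i →+ N.carrier i
  map_act : ∀ {i j n : ℤ} (h : i + j = n) (x : M.carrier i) (a : l.carrier j),
    app n (M.act h x a) = N.act h (app i x) a

instance : Category (GrMod l) where
  Hom := Hom
  id M := ⟨fun _ => AddMonoidHom.id _, fun _ _ _ => rfl⟩
  comp f g := ⟨fun i => (g.app i).comp (f.app i), fun h a b => by simp [f.map_act, g.map_act]⟩

variable {l} in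
@[ext]
theorem hom_ext {M N : GrMod l} {f g : M ⟶ N} (h : ∀ i x, f.app i x = g.app i x) : f = g :=
  Hom.ext (funext fun i => AddMonoidHom.ext (h i))

/-- The underlying graded abelian group of a graded module. -/
def toGrAb : GrMod l ⥤ GradedObject ℤ AddCommGrpCat.{u} where
  obj M i := AddCommGrpCat.of (M.carrier i)
  map f i := AddCommGrpCat.ofHom (f.app i)

end GrMod

/-- The underlying graded set of a graded abelian group. -/
def grAbForget : GradedObject ℤ AddCommGrpCat.{u} ⥤ GradedObject ℤ (Type u) :=
  Functor.pi fun _ => forget AddCommGrpCat.{u}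

namespace GrMod

variable (l : GrRing.{u})

/-- The underlying graded set of a graded module. -/
def toGrSet : GrMod l ⥤ GradedObject ℤ (Type u) := toGrAb l ⋙ grAbForget

/-- Degree `n` basis for the free graded module on a graded set `S`: pairs consisting of an element
of `S` of degree `deg` and a degree `j` for its coefficient, with `deg + j = n`. -/
structure FreeIdx (S : GradedObject ℤ (Type u)) (n : ℤ) : Type u where
  deg : ℤ
  gen : S deg
  j : ℤ
  h : deg + j = n

section
open scoped Classical DirectSum

variable {l} {S : GradedObject ℤ (Type u)}

/-- The element `s a` of the free graded module. -/
noncomputable def freeMk {n : ℤ} (i : ℤ) (s : S i) (j : ℤ) (h : i + j = n) :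
    l.carrier j →+ ⨁ t : FreeIdx S n, l.carrier t.j :=
  DirectSum.of (fun t : FreeIdx S n => l.carrier t.j) ⟨i, s, j, h⟩

/-- The right action on the free graded module: `(s b) a = s (b a)`. -/
noncomputable def freeAct {m j n : ℤ} (h : m + j = n) :
    (⨁ t : FreeIdx S m, l.carrier t.j) →+ l.carrier j →+ ⨁ t : FreeIdx S n, l.carrier t.j :=
  DirectSum.toAddMonoid fun t => AddMonoidHom.mk' (fun b =>
    (freeMk t.deg t.gen (t.j + j) (by have := t.h; omega)).comp (l.mul rfl b))
    fun b b' => by ext a; simp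

theorem freeAct_freeMk {m j n r : ℤ} (h : m + j = n) (i : ℤ) (s : S i) (q : ℤ) (hq : i + q = m)
    (b : l.carrier q) (a : l.carrier j) (hr : q + j = r) (hn : i + r = n) :
    freeAct h (freeMk i s q hq b) a = freeMk i s r hn (l.mul hr b a) := by
  subst hr
  simp [freeAct, freeMk]

theorem free_induction {n : ℤ} {p : (⨁ t : FreeIdx S n, l.carrier t.j) → Prop}
    (x : ⨁ t : FreeIdx S n, l.carrier t.j) (zero : p 0)
    (mk : ∀ (i : ℤ) (s : S i) (j : ℤ) (h : i + j = n) (a : l.carrier j), p (freeMk i s j h a))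
    (add : ∀ x y, p x → p y → p (x + y)) : p x :=
  DirectSum.induction_on x zero (fun t a => mk t.deg t.gen t.j t.h a) add

variable (l) in
/-- The free graded right `l`-module on a graded set `S`: its elements of degree `n` are the finite
sums of `s a` with `s` in `S` of degree `i`, `a` in `l` of degree `j`, and `i + j = n`. -/
noncomputable def freeObj (S : GradedObject ℤ (Type u)) : GrMod l where
  carrier n := ⨁ t : FreeIdx S n, l.carrier t.j
  act h := freeAct h
  act_one h x := by
    induction x using free_induction with
    | zero => simp
    | mk i s j hj a => rw [freeAct_freeMk h i s j hj a l.one (add_zero j) hj, l.mul_one]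
    | add x y hx hy => simp [hx, hy]
  act_mul {i j m ij jm n} hij hn hjm hn' x a b := by
    induction x using free_induction with
    | zero => simp
    | mk q s r hr c =>
      rw [freeAct_freeMk hij q s r hr c a rfl (by omega),
        freeAct_freeMk hn q s (r + j) _ _ b rfl (by omega),
        freeAct_freeMk hn' q s r hr c _ (show r + jm = r + j + m by omega) (by omega),
        l.mul_assoc rfl rfl hjm (by omega)]
    | add x y hx hy => simp [hx, hy]

/-- The homomorphism out of the free graded module that extends a map of graded sets. -/
noncomputable def freeLift {M : GrMod l} (f : ∀ i, S i → M.carrier i) : freeObj l S ⟶ M where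
  app n := DirectSum.toAddMonoid (β := fun t : FreeIdx S n => l.carrier t.j)
    fun t => M.act t.h (f t.deg t.gen)
  map_act {i j n} h x a := by
    change DirectSum.toAddMonoid _ (freeAct h x a) = M.act h (DirectSum.toAddMonoid _ x) a
    induction x using free_induction with
    | zero => simp only [map_zero, AddMonoidHom.zero_apply]
    | mk q s r hr c =>
      rw [freeAct_freeMk h q s r hr c a rfl (by omega)]
      refine (DirectSum.toAddMonoid_of _ _ _).trans ?_
      refine Eq.trans ?_ (congrArg (fun y => M.act h y a) (DirectSum.toAddMonoid_of _ _ _).symm)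
      exact (M.act_mul hr h rfl _ _ _ _).symm
    | add x y hx hy => simp only [map_add, AddMonoidHom.add_apply, hx, hy]

variable (l S) in
/-- The universal property of the free graded module. -/
noncomputable def freeEquiv (M : GrMod l) : (freeObj l S ⟶ M) ≃ (S ⟶ (toGrSet l).obj M) where
  toFun g i := TypeCat.ofHom fun s => g.app i (freeMk i s 0 (add_zero i) l.one)
  invFun f := freeLift fun i s => f i s
  left_inv g := by
    refine hom_ext fun n x => ?_
    induction x using free_induction with
    | zero => exact (map_zero _).trans (map_zero _).symm
    | mk i s j hj a =>
      refine (DirectSum.toAddMonoid_of _ _ _).trans ?_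
      refine (g.map_act hj _ a).symm.trans ?_
      refine congrArg (g.app n) ?_
      refine (freeAct_freeMk hj i s 0 (add_zero i) l.one a (zero_add j) hj).trans ?_
      rw [l.one_mul]
    | add x y hx hy =>
      exact (map_add _ _ _).trans ((congrArg₂ (· + ·) hx hy).trans (map_add _ _ _).symm)
  right_inv f := by
    funext i
    ext s
    exact (DirectSum.toAddMonoid_of (fun t : FreeIdx S i => M.act t.h (f t.deg t.gen : M.carrier t.deg))
      ⟨i, s, 0, add_zero i⟩ l.one).trans (M.act_one _ _)

end

/-- The free graded module functor from graded sets to graded `l`-modules. -/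
noncomputable def free : GradedObject ℤ (Type u) ⥤ GrMod l :=
  Adjunction.leftAdjointOfEquiv (freeEquiv l) fun _ _ _ _ _ => rfl

/-- The free graded module functor is left adjoint to the forgetful functor. -/
noncomputable def freeAdj : free l ⊣ toGrSet l :=
  Adjunction.adjunctionOfEquivLeft (freeEquiv l) fun _ _ _ _ _ => rfl

end GrMod

section Pro

/-- The category of pro-(graded commutative `k`-algebras), i.e. of small cofiltered diagrams of such
algebras; it is the opposite of the category of ind-objects of the opposite category. -/
abbrev ProAlg (k : GrCommRing.{u}) : Type (u + 1) := (Ind (GrAlg k)ᵒᵖ)ᵒᵖ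

variable (k : GrCommRing.{u})

/-- The inclusion of algebras as constant pro-algebras. -/
noncomputable def ProAlg.const : GrAlg k ⥤ ProAlg k := (Ind.yoneda (C := (GrAlg k)ᵒᵖ)).rightOp

instance : HasFiniteLimits (GrAlg k)ᵒᵖ :=
  have : HasFiniteColimits (GrAlg k) := inferInstance
  inferInstance

instance : HasFiniteProducts (ProAlg k)ᵒᵖ :=
  have : HasFiniteCoproducts (ProAlg k) := inferInstance
  inferInstance

/-- The opposite of the category of pro-algebras with its cartesian monoidal structure, i.e. the
category of pro-algebras with its finite coproducts, which are the tensor products over `k`. -/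
noncomputable instance : CartesianMonoidalCategory (ProAlg k)ᵒᵖ := .ofHasFiniteProducts

noncomputable instance : BraidedCategory (ProAlg k)ᵒᵖ := .ofCartesianMonoidalCategory

/-- The category of cocommutative Hopf pro-algebras over `k`: pro-algebras `A` with a coassociative
and cocommutative comultiplication `A ⟶ A ⊗ A`, a counit `A ⟶ k` and an antipode `A ⟶ A`, all of
them morphisms of pro-algebras. In other words, commutative cogroup objects in pro-algebras. -/
abbrev HopfProAlg : Type (u + 1) := (CommGrp (ProAlg k)ᵒᵖ)ᵒᵖ

/-- The underlying pro-algebra of a Hopf pro-algebra. -/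
noncomputable def HopfProAlg.forget : HopfProAlg k ⥤ ProAlg k :=
  (CommGrp.forget (ProAlg k)ᵒᵖ).leftOp

end Pro

/-- A set-valued functor is ind-representable if it is a small filtered colimit of representable
(i.e. corepresentable) functors `C(X, -)`. -/
def IsIndRepresentable {C : Type (u + 1)} [Category.{u} C] (F : C ⥤ Type u) : Prop :=
  IsIndObject (C := Cᵒᵖ) (unopUnop C ⋙ F)

section FormalSchemes

variable (k : GrCommRing.{u}) (l : GrRing.{u})

/-- A functor from graded commutative `k`-algebras to graded sets is ind-representable if it is so
in each degree. -/
def isFormalScheme : ObjectProperty (GrAlg k ⥤ GradedObject ℤ (Type u)) :=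
  fun F => ∀ q : ℤ, IsIndRepresentable (F ⋙ GradedObject.eval q)

/-- The category of (affine, graded) formal schemes over `k`. -/
abbrev FSch : Type (u + 1) := (isFormalScheme k).FullSubcategory

/-- The category of commutative formal group schemes over `k`, i.e. of formal `ℤ`-module schemes:
functors to graded abelian groups (= graded modules over `ℤ` placed in degree zero) whose underlying functor to graded sets is a formal scheme. -/
abbrev FGrpSch : Type (u + 1) :=
  ObjectProperty.FullSubcategory fun F : GrAlg k ⥤ GradedObject ℤ AddCommGrpCat.{u} =>
    isFormalScheme k (F ⋙ grAbForget)

/-- The category of formal `l`-module schemes over `k`: functors to graded `l`-modules whose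
underlying functor to graded sets is a formal scheme. -/
abbrev FModSch : Type (u + 1) :=
  ObjectProperty.FullSubcategory fun F : GrAlg k ⥤ GrMod l =>
    isFormalScheme k (F ⋙ GrMod.toGrSet l)

/-- The forgetful functor from commutative formal group schemes to formal schemes. -/
def FGrpSch.forget : FGrpSch k ⥤ FSch k :=
  ObjectProperty.lift _ (ObjectProperty.ι _ ⋙ (Functor.whiskeringRight _ _ _).obj grAbForget)
    fun F => F.property

/-- The forgetful functor from formal `l`-module schemes to formal schemes. -/
def FModSch.forget : FModSch k l ⥤ FSch k :=
  ObjectProperty.lift _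
    (ObjectProperty.ι _ ⋙ (Functor.whiskeringRight _ _ _).obj (GrMod.toGrSet l))
    fun F => F.property

/-- The restriction functor from formal `l`-module schemes to commutative formal group schemes. -/
def FModSch.res : FModSch k l ⥤ FGrpSch k :=
  ObjectProperty.lift _
    (ObjectProperty.ι _ ⋙ (Functor.whiskeringRight _ _ _).obj (GrMod.toGrAb l))
    fun F => F.property

section YonedaAb

open scoped MonObj

/-- For a commutative group object `G` of a category with finite products, the presheaf of abelian
groups `X ↦ Hom(X, G)`, written additively. -/
def yonedaAb {D : Type (u + 1)} [Category.{u} D] [CartesianMonoidalCategory D] [BraidedCategory D] :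
    CommGrp D ⥤ Dᵒᵖ ⥤ AddCommGrpCat.{u} where
  obj G :=
    { obj X := AddCommGrpCat.of (Additive (X.unop ⟶ G.X))
      map g := AddCommGrpCat.ofHom (AddMonoidHom.mk' (fun x => .ofMul (g.unop ≫ x.toMul))
        fun x y => congrArg Additive.ofMul (MonObj.comp_mul g.unop x.toMul y.toMul))
      map_id X := by
        refine AddCommGrpCat.hom_ext (AddMonoidHom.ext fun x => ?_)
        exact Category.id_comp (Additive.toMul x)
      map_comp f g := by
        refine AddCommGrpCat.hom_ext (AddMonoidHom.ext fun x => ?_)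
        exact Category.assoc g.unop f.unop (Additive.toMul x) }
  map f :=
    { app X := AddCommGrpCat.ofHom (AddMonoidHom.mk' (fun x => .ofMul (x.toMul ≫ f.hom.hom.hom))
        fun x y => congrArg Additive.ofMul (MonObj.mul_comp x.toMul y.toMul f.hom.hom.hom))
      naturality X Y g := by
        refine AddCommGrpCat.hom_ext (AddMonoidHom.ext fun x => ?_)
        exact Category.assoc g.unop (Additive.toMul x) f.hom.hom.hom }
  map_id G := by
    refine NatTrans.ext (funext fun X => AddCommGrpCat.hom_ext (AddMonoidHom.ext fun x => ?_))
    exact Category.comp_id (Additive.toMul x)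
  map_comp f g := by
    refine NatTrans.ext (funext fun X => AddCommGrpCat.hom_ext (AddMonoidHom.ext fun x => ?_))
    exact (Category.assoc (Additive.toMul x) f.hom.hom.hom g.hom.hom.hom).symm

end YonedaAb

section Spf

/-- The functor `R ↦ Hom(A, R)` on algebras that is ind-represented by a pro-algebra `A`. -/
noncomputable def spfPoints : (ProAlg k)ᵒᵖ ⥤ GrAlg k ⥤ Type u :=
  yoneda ⋙ (Functor.whiskeringLeft _ _ _).obj (ProAlg.const k ⋙ opOp _)

theorem spfPoints_isIndRepresentable (A : (ProAlg k)ᵒᵖ) :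
    IsIndRepresentable ((spfPoints k).obj A) := by
  let X : Ind (GrAlg k)ᵒᵖ := A.unop.unop
  let t (R : (GrAlg k)ᵒᵖᵒᵖ) : (op ((ProAlg.const k).obj R.unop.unop) ⟶ A) ≃
      ((Ind.inclusion (GrAlg k)ᵒᵖ).obj X).obj R :=
    (opEquiv _ A).trans <| (opEquiv _ (op (Ind.yoneda.obj R.unop))).trans <|
      (Ind.inclusion.fullyFaithful (C := (GrAlg k)ᵒᵖ)).homEquiv.trans <|
      (Iso.homFromEquiv (Ind.yonedaCompInclusion.app R.unop)).trans yonedaEquiv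
  have key {R S : (GrAlg k)ᵒᵖ} (g : S ⟶ R) (f : Ind.yoneda.obj R ⟶ X) :
      yonedaEquiv (Ind.yonedaCompInclusion.inv.app S ≫ (Ind.inclusion _).map (Ind.yoneda.map g ≫ f))
        = ((Ind.inclusion (GrAlg k)ᵒᵖ).obj X).map g.op (yonedaEquiv
          (Ind.yonedaCompInclusion.inv.app R ≫ (Ind.inclusion (GrAlg k)ᵒᵖ).map f)) := by
    rw [yonedaEquiv_naturality, Functor.map_comp, ← Category.assoc, ← Category.assoc]
    exact congrArg (fun h => yonedaEquiv (h ≫ (Ind.inclusion (GrAlg k)ᵒᵖ).map f))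
      (Ind.yonedaCompInclusion.inv.naturality g).symm
  let e : unopUnop (GrAlg k) ⋙ (spfPoints k).obj A ≅ (Ind.inclusion (GrAlg k)ᵒᵖ).obj X :=
    NatIso.ofComponents (fun R => (t R).toIso) fun {R S} g => by
      ext f
      change t S (((ProAlg.const k).map g.unop.unop).op ≫ f) =
        ((Ind.inclusion (GrAlg k)ᵒᵖ).obj X).map g (t R f)
      exact key g.unop (Quiver.Hom.unop (Quiver.Hom.unop f))
  exact (Ind.isIndObject_inclusion_obj X).map e.inv

/-- The formal spectrum of a graded family of pro-algebras: in degree `q`, the functor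
`R ↦ Hom(A q, R)`. -/
noncomputable def Spf : GradedObject ℤ (ProAlg k)ᵒᵖ ⥤ FSch k :=
  ObjectProperty.lift _
    { obj A := Functor.pi' fun q => (spfPoints k).obj (A q)
      map f := { app R q := ((spfPoints k).map (f q)).app R
                 naturality R S g := funext fun q => ((spfPoints k).map (f q)).naturality g } }
    fun A q => spfPoints_isIndRepresentable k (A q)

/-- For a Hopf pro-algebra `H`, the functor `R ↦ Hom(H, R)` from algebras to abelian groups, with
addition induced by the comultiplication of `H`. -/
noncomputable def spfGrpPoints : CommGrp (ProAlg k)ᵒᵖ ⥤ GrAlg k ⥤ AddCommGrpCat.{u} :=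
  yonedaAb ⋙ (Functor.whiskeringLeft _ _ _).obj (ProAlg.const k ⋙ opOp _)

/-- The formal spectrum of a graded family of cocommutative Hopf pro-algebras, as a commutative
formal group scheme. -/
noncomputable def SpfGrp : GradedObject ℤ (CommGrp (ProAlg k)ᵒᵖ) ⥤ FGrpSch k :=
  ObjectProperty.lift _
    { obj H := Functor.pi' fun q => (spfGrpPoints k).obj (H q)
      map f := { app R q := ((spfGrpPoints k).map (f q)).app R
                 naturality R S g := funext fun q => ((spfGrpPoints k).map (f q)).naturality g }
      map_id H := by
        ext R q : 3
        exact congrArg (fun t => t.app R) ((spfGrpPoints k).map_id (H q))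
      map_comp f g := by
        ext R q : 3
        exact congrArg (fun t => t.app R) ((spfGrpPoints k).map_comp (f q) (g q)) }
    fun H q => spfPoints_isIndRepresentable k (H q).X

/-- The formal scheme underlying the formal spectrum of a family of Hopf pro-algebras is the formal
spectrum of the underlying family of pro-algebras. -/
noncomputable def spfGrpForget : SpfGrp k ⋙ FGrpSch.forget k ≅
    Functor.pi (fun _ => CommGrp.forget _) ⋙ Spf k :=
  Iso.refl _

end Spf

/-- For a left adjoint `L` of the forgetful functor from formal `l`-module schemes to formal schemes
and a formal scheme `F`, the natural transformation from the objectwise free module functor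
`R ↦ free (F R)` to `L F` that extends the unit `F ⟶ L F`. -/
noncomputable def freeComparison {k : GrCommRing.{u}} {l : GrRing.{u}} {L : FSch k ⥤ FModSch k l}
    (adj : L ⊣ FModSch.forget k l) (F : FSch k) : F.obj ⋙ GrMod.free l ⟶ (L.obj F).obj :=
  Functor.whiskerRight (adj.unit.app F).hom (GrMod.free l) ≫
    Functor.whiskerLeft (L.obj F).obj (GrMod.freeAdj l).counit

end FormalSchemes

/-! A set-valued functor on algebras is ind-representable exactly when it preserves finite limits
and is generated by a small family of elements (`IsIndRepresentable.isLex`,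
`IsIndRepresentable.isSmallGen`, `IsLex.isIndRepresentable`). So a formal `l`-module scheme is a
module-valued functor that is lex and small-generated in each degree, and the left adjoints and
colimits amount to initial arrows from a set-valued functor `F` into such functors.

These arrows come from `exists_initial_arrow`, a solution-set argument. Fix a small family of
algebras that carries generators of `F` and is closed under coproducts and pullbacks; it exists
because the pullback of a cospan of algebras is determined by a set of pairs of elements. Over this
family there is only a small set of formal expressions in the module operations, the functorial maps
and gluing along pullbacks. Expressions have partial values in every lex target, and only a small
number of patterns of common values occur. Choose one target for each pattern, and let `I` be the
smallest lex submodule functor of their product that contains the image of `F`. Sending the value of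
an expression in the product to its value in another target is well defined: two descriptions of one
element are compared over a pullback, by an expression that has a value in the target as well.
Moreover, elements of `I` are separated by arrows of the class, so `F → I` inherits additivity or
compatibility with a diagram from them. Varying the class gives the left adjoints of
`FModSch.forget` and `FModSch.res`, and all colimits.

Limits are formed objectwise, since ind-objects are closed under limits of presheaves. Monadicity is
Beck's theorem: a split coequalizer of the underlying schemes inherits a module structure along its
section, and its underlying functor is already a formal scheme. Commutative formal group schemes are
reduced to the case of the integers in degree zero.

For the Hopf algebra description, constant pro-algebras detect and construct morphisms of
pro-algebras. Hence `SpfGrp` is an equivalence from families of commutative cogroups to formal group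
schemes. The free group scheme on a constant family, read in one degree, gives the cofree Hopf
pro-algebra, and uniqueness of universal arrows gives the comparison with `Spf`. The objectwise free
module has the same maps into `G` as `Fr_l(F)`, because both classify natural maps of graded sets
from `F` to `G`. -/

section Lex

/-! ### Ind-representable functors as lex, small-generated functors. -/

variable {C : Type (u + 1)} [Category.{u} C]

/-- A set-valued functor is lex if it has one element on terminal objects and takes pullback
squares to pullback squares. -/
structure IsLex (F : C ⥤ Type u) : Prop where
  terminal : ∀ {X : C}, IsTerminal X → Nonempty (F.obj X) ∧ Subsingleton (F.obj X)
  exists_lift : ∀ {P X Y Z : C} {p : P ⟶ X} {q : P ⟶ Y} {f : X ⟶ Z} {g : Y ⟶ Z},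
    IsPullback p q f g → ∀ (x : F.obj X) (y : F.obj Y), F.map f x = F.map g y →
      ∃ z, F.map p z = x ∧ F.map q z = y
  ext : ∀ {P X Y Z : C} {p : P ⟶ X} {q : P ⟶ Y} {f : X ⟶ Z} {g : Y ⟶ Z},
    IsPullback p q f g → ∀ z z' : F.obj P, F.map p z = F.map p z' → F.map q z = F.map q z' → z = z'

/-- A set-valued functor is small-generated if all its elements are images of elements in a small
family. -/
def IsSmallGen (F : C ⥤ Type u) : Prop :=
  ∃ (S : Type u) (B : S → C) (x : ∀ s, F.obj (B s)),
    ∀ (A : C) (a : F.obj A), ∃ (s : S) (f : B s ⟶ A), F.map f (x s) = a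

theorem IsLex.preservesFiniteLimits [HasFiniteLimits C] {F : C ⥤ Type u} (h : IsLex F) :
    PreservesFiniteLimits F := by
  have h₁ : PreservesLimitsOfShape (Discrete.{0} PEmpty) F := by
    have := (h.terminal terminalIsTerminal).2
    have := uniqueOfSubsingleton (h.terminal terminalIsTerminal).1.some
    have := preservesTerminal_of_iso F
      ((Types.isTerminalEquivUnique (F.obj (⊤_ C))).symm this |>.uniqueUpToIso terminalIsTerminal)
    exact preservesLimitsOfShape_pempty_of_preservesTerminal F
  have h₂ : PreservesLimitsOfShape WalkingCospan F := by
    refine ⟨fun {K} => ?_⟩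
    refine @preservesLimit_of_iso_diagram _ _ _ _ _ _ _ _ F (diagramIsoCospan K).symm ?_
    have hp := IsPullback.of_hasPullback (K.map WalkingCospan.Hom.inl) (K.map WalkingCospan.Hom.inr)
    refine preservesLimit_of_preserves_limit_cone hp.isLimit ?_
    refine (isLimitMapConePullbackConeEquiv F hp.w).symm ?_
    have : IsPullback (F.map (pullback.fst (K.map WalkingCospan.Hom.inl) (K.map WalkingCospan.Hom.inr)))
        (F.map (pullback.snd (K.map WalkingCospan.Hom.inl) (K.map WalkingCospan.Hom.inr)))
        (F.map (K.map WalkingCospan.Hom.inl)) (F.map (K.map WalkingCospan.Hom.inr)) := by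
      rw [Types.isPullback_iff]
      refine ⟨by rw [← F.map_comp, ← F.map_comp, hp.w], fun x y hxy => h.ext hp x y hxy.1 hxy.2,
        fun x y hxy => h.exists_lift hp x y hxy⟩
    exact this.isLimit
  exact preservesFiniteLimits_of_preservesTerminal_and_pullbacks F

/-- By the Yoneda lemma the coprojections of a filtered colimit of representables are elements `ξ
i`; the three clauses are compatibility, joint surjectivity, and the criterion for equality in a
filtered colimit. -/
theorem IsIndRepresentable.exists_presentation {F : C ⥤ Type u} (h : IsIndRepresentable F) :
    ∃ (I : Type u) (_ : SmallCategory I) (_ : IsFiltered I) (r : I ⥤ Cᵒᵖ)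
      (ξ : ∀ i, F.obj (r.obj i).unop),
      (∀ {i j} (f : i ⟶ j), F.map (r.map f).unop (ξ j) = ξ i) ∧
      (∀ (A : C) (x : F.obj A), ∃ (i : I) (a : (r.obj i).unop ⟶ A), F.map a (ξ i) = x) ∧
      ∀ (i : I) (A : C) (a b : (r.obj i).unop ⟶ A), F.map a (ξ i) = F.map b (ξ i) →
        ∃ (j : I) (f : i ⟶ j), (r.map f).unop ≫ a = (r.map f).unop ≫ b := by
  obtain P := h.presentation
  let ξ (i : P.I) : F.obj (P.F.obj i).unop := (P.ι.app i).app (op (P.F.obj i)) (𝟙 _)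
  have key (i : P.I) (A : C) (a : (P.F.obj i).unop ⟶ A) :
      F.map a (ξ i) = (P.ι.app i).app (op (op A)) a.op := by
    have := types_congr_hom ((P.ι.app i).naturality (X := op (P.F.obj i))
      (Y := op (op A)) a.op.op) (𝟙 (P.F.obj i))
    refine this.symm.trans ?_
    change (P.ι.app i).app (op (op A)) (a.op ≫ 𝟙 _) = _
    rw [Category.comp_id]
  let hc (A : C) := isColimitOfPreserves ((evaluation _ _).obj (op (op A))) P.isColimit
  refine ⟨P.I, inferInstance, inferInstance, P.F, ξ, fun {i j} f => ?_, fun A x => ?_,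
    fun i A a b hab => ?_⟩
  · rw [key]
    have := congrArg (fun t => t.app (op (P.F.obj i)) (𝟙 (P.F.obj i))) (P.ι.naturality f)
    refine Eq.trans ?_ this
    change (P.ι.app j).app _ _ = (P.ι.app j).app _ (𝟙 _ ≫ P.F.map f)
    rw [Category.id_comp]
    rfl
  · obtain ⟨i, a, ha⟩ := Types.jointly_surjective_of_isColimit (hc A) x
    exact ⟨i, Quiver.Hom.unop a, (key _ _ _).trans ha⟩
  · rw [key, key] at hab
    obtain ⟨j, f, hf⟩ := (Types.FilteredColimit.isColimit_eq_iff' (hc A) a.op b.op).1 hab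
    exact ⟨j, f, Quiver.Hom.op_inj hf⟩

theorem IsIndRepresentable.isSmallGen {F : C ⥤ Type u} (h : IsIndRepresentable F) :
    IsSmallGen F := by
  obtain ⟨I, _, _, r, ξ, -, h, -⟩ := h.exists_presentation
  exact ⟨I, fun i => (r.obj i).unop, ξ, h⟩

/-- Filtered colimits commute with finite limits: any two elements come from a common index, and
equations between them hold at a later index, where the universal property in `C` applies. -/
theorem IsIndRepresentable.isLex {F : C ⥤ Type u} (h : IsIndRepresentable F) :
    IsLex F := by
  obtain ⟨I, _, _, r, ξ, hr, h₁, h₂⟩ := h.exists_presentation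
  have up {i j : I} (f : i ⟶ j) {A : C} (a : (r.obj i).unop ⟶ A) :
      F.map ((r.map f).unop ≫ a) (ξ j) = F.map a (ξ i) := by
    rw [F.map_comp_apply, hr]
  have common {A B : C} (x : F.obj A) (y : F.obj B) : ∃ (i : I) (a : (r.obj i).unop ⟶ A)
      (b : (r.obj i).unop ⟶ B), F.map a (ξ i) = x ∧ F.map b (ξ i) = y := by
    obtain ⟨i, a, ha⟩ := h₁ A x
    obtain ⟨j, b, hb⟩ := h₁ B y
    exact ⟨IsFiltered.max i j, (r.map (IsFiltered.leftToMax i j)).unop ≫ a,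
      (r.map (IsFiltered.rightToMax i j)).unop ≫ b, by rw [up, ha], by rw [up, hb]⟩
  constructor
  · intro X hX
    refine ⟨⟨F.map (hX.from _) (ξ IsFiltered.nonempty.some)⟩, ⟨fun x y => ?_⟩⟩
    obtain ⟨i, a, b, rfl, rfl⟩ := common x y
    rw [hX.hom_ext a b]
  · intro P X Y Z p q f g hp x y hxy
    obtain ⟨i, a, b, rfl, rfl⟩ := common x y
    rw [← F.map_comp_apply, ← F.map_comp_apply] at hxy
    obtain ⟨j, φ, hφ⟩ := h₂ _ _ _ _ hxy
    refine ⟨F.map (hp.lift ((r.map φ).unop ≫ a) ((r.map φ).unop ≫ b) (by simpa using hφ)) (ξ j),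
      ?_, ?_⟩
    · rw [← F.map_comp_apply, hp.lift_fst, up]
    · rw [← F.map_comp_apply, hp.lift_snd, up]
  · intro P X Y Z p q f g hp z z' h h'
    obtain ⟨i, a, b, rfl, rfl⟩ := common z z'
    rw [← F.map_comp_apply, ← F.map_comp_apply] at h h'
    obtain ⟨j, φ, hφ⟩ := h₂ _ _ _ _ h
    -- The index `j` equalizes the components along `p`; a further index is needed for those along
    -- `q`.
    obtain ⟨m, ψ, hψ⟩ := h₂ j _ ((r.map φ).unop ≫ a ≫ q) ((r.map φ).unop ≫ b ≫ q)
      (by rw [up, up, h'])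
    have : (r.map (φ ≫ ψ)).unop ≫ a = (r.map (φ ≫ ψ)).unop ≫ b := by
      refine hp.hom_ext ?_ ?_
      · simp only [r.map_comp, unop_comp, Category.assoc]
        exact congrArg ((r.map ψ).unop ≫ ·) hφ
      · simpa only [r.map_comp, unop_comp, Category.assoc] using hψ
    rw [← up (φ ≫ ψ), this, up]

/-- Finite limits make the category of elements filtered, and a small generating family is weakly
terminal in it. So a small filtered diagram suffices although `C` is large. -/
theorem IsLex.isIndRepresentable [HasFiniteLimits C] {F : C ⥤ Type u} (h : IsLex F)
    (h' : IsSmallGen F) : IsIndRepresentable F := by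
  have := h.preservesFiniteLimits
  have : PreservesFiniteLimits (unopUnop C) :=
    inferInstanceAs (PreservesFiniteLimits (opOpEquivalence C).functor)
  have : PreservesFiniteLimits (unopUnop C ⋙ F) := comp_preservesFiniteLimits _ _
  have : IsFiltered (CostructuredArrow yoneda (unopUnop C ⋙ F)) :=
    isFiltered_costructuredArrow_yoneda_of_preservesFiniteLimits _
  have : FinallySmall.{u} (CostructuredArrow yoneda (unopUnop C ⋙ F)) := by
    obtain ⟨S, B, x, hx⟩ := h'
    let m (s : S) : CostructuredArrow yoneda (unopUnop C ⋙ F) :=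
      CostructuredArrow.mk (Y := op (B s)) (yonedaEquiv.symm (x s))
    refine finallySmall_of_small_weakly_terminal_set (Set.range m) fun i => ?_
    obtain ⟨s, f, hf⟩ := hx i.left.unop (yonedaEquiv i.hom)
    refine ⟨m s, ⟨s, rfl⟩, ⟨CostructuredArrow.homMk f.op ?_⟩⟩
    apply yonedaEquiv.injective
    refine (yonedaEquiv_naturality _ _).symm.trans (Eq.trans ?_ hf)
    have : yonedaEquiv (m s).hom = x s :=
      Equiv.apply_symm_apply (yonedaEquiv (F := unopUnop C ⋙ F)) (x s)
    exact congrArg (F.map f) this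
  exact isIndObject_of_isFiltered_of_finallySmall _

end Lex

/-! ### Small families closed under coproducts and pullbacks. -/

section ClosedFamily

variable (C : Type (u + 1)) [Category.{u} C]

/-- For any two objects, small many squares suffice to represent all pullbacks of cospans on these
two objects. -/
def HasSmallPullbackFamilies : Prop :=
  ∀ A B : C, ∃ (S : Type u) (P : S → C) (p : ∀ s, P s ⟶ A) (q : ∀ s, P s ⟶ B),
    ∀ {X : C} (f : A ⟶ X) (g : B ⟶ X), ∃ s, IsPullback (p s) (q s) f g

variable {C}

/-- A family of objects that contains an initial object and is closed under binary coproducts and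
under pullbacks over arbitrary objects. -/
structure IsClosedFamily {T : Type u} (r : T → C) : Prop where
  initial : ∃ t, Nonempty (IsInitial (r t))
  coprod : ∀ t t', ∃ (t'' : T) (i : r t ⟶ r t'') (j : r t' ⟶ r t''),
    Nonempty (IsColimit (BinaryCofan.mk i j))
  pullback : ∀ {t t'} {X : C} (f : r t ⟶ X) (g : r t' ⟶ X),
    ∃ (t'' : T) (p : r t'' ⟶ r t) (q : r t'' ⟶ r t'), IsPullback p q f g

theorem exists_isClosedFamily [HasFiniteCoproducts C] (hC : HasSmallPullbackFamilies C)
    {S : Type u} (B : S → C) :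
    ∃ (T : Type u) (r : T → C) (i : S → T), IsClosedFamily r ∧ ∀ s, r (i s) = B s := by
  choose σ P p q hP using hC
  -- One stage keeps the old objects and adds binary coproducts and a representative of every
  -- pullback over any base. The union of the countably many stages is closed, because two members
  -- always occur together in some stage.
  let step (F : Σ T : Type u, T → C) : Σ T : Type u, T → C :=
    ⟨F.1 ⊕ (F.1 × F.1) ⊕ (Σ t : F.1 × F.1, σ (F.2 t.1) (F.2 t.2)),
      Sum.elim F.2 (Sum.elim (fun t => F.2 t.1 ⨿ F.2 t.2) fun t => P _ _ t.2)⟩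
  let fam (n : ℕ) : Σ T : Type u, T → C :=
    n.rec ⟨S ⊕ PUnit.{u + 1}, Sum.elim B fun _ => ⊥_ C⟩ fun _ F => step F
  have up {n m : ℕ} (h : n ≤ m) (t : (fam n).1) : ∃ t' : (fam m).1, (fam m).2 t' = (fam n).2 t := by
    induction h with
    | refl => exact ⟨t, rfl⟩
    | step _ ih =>
      obtain ⟨t', ht'⟩ := ih
      exact ⟨.inl t', ht'⟩
  have common (t t' : Σ n, (fam n).1) : ∃ (n : ℕ) (s s' : (fam n).1),
      (fam n).2 s = (fam t.1).2 t.2 ∧ (fam n).2 s' = (fam t'.1).2 t'.2 := by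
    obtain ⟨s, hs⟩ := up (le_max_left t.1 t'.1) t.2
    obtain ⟨s', hs'⟩ := up (le_max_right t.1 t'.1) t'.2
    exact ⟨_, s, s', hs, hs'⟩
  refine ⟨Σ n, (fam n).1, fun t => (fam t.1).2 t.2, fun s => ⟨0, .inl s⟩, ⟨?_, ?_, ?_⟩,
    fun _ => rfl⟩
  · exact ⟨⟨0, .inr ⟨⟩⟩, ⟨initialIsInitial⟩⟩
  · intro t t'
    obtain ⟨n, s, s', hs, hs'⟩ := common t t'
    rw [← hs, ← hs']
    exact ⟨⟨n + 1, .inr (.inl (s, s'))⟩, coprod.inl, coprod.inr, ⟨coprodIsCoprod _ _⟩⟩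
  · intro t t' X f g
    obtain ⟨n, s, s', hs, hs'⟩ := common t t'
    revert f g
    rw [← hs, ← hs']
    intro f g
    obtain ⟨a, ha⟩ := hP _ _ f g
    exact ⟨⟨n + 1, .inr (.inr ⟨(s, s'), a⟩)⟩, _, _, ha⟩

end ClosedFamily

/-! ### Limits of graded commutative rings. -/

namespace GrCommRing

section Limits

variable {J : Type u} [SmallCategory J] (F : J ⥤ GrCommRing.{u})

/-- The compatible families of elements of degree `i`. -/
def sections (i : ℤ) : AddSubgroup (∀ j, (F.obj j).carrier i) where
  carrier := { x | ∀ (j j' : J) (f : j ⟶ j'), (F.map f).app i (x j) = x j' }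
  zero_mem' := by intro j j' f; simp
  add_mem' := fun hx hy j j' f => by simp [hx j j' f, hy j j' f]
  neg_mem' := fun hx j j' f => by simp [hx j j' f]

/-- The componentwise product of compatible families. -/
def sectionsMul {i j n : ℤ} (h : i + j = n) : sections F i →+ sections F j →+ sections F n :=
  AddMonoidHom.mk' (fun x => AddMonoidHom.mk' (fun y =>
      ⟨fun j => (F.obj j).mul h (x.1 j) (y.1 j), fun _ _ f => by
        rw [(F.map f).map_mul, x.2 _ _ f, y.2 _ _ f]⟩)
      fun y z => Subtype.ext (funext fun j => map_add _ _ _))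
      fun x y => AddMonoidHom.ext fun z => Subtype.ext (funext fun j =>
        congrArg (fun t => t (z.1 j)) (map_add ((F.obj j).mul h) (x.1 j) (y.1 j)))

theorem sectionsMul_comm {i j n : ℤ} (h : i + j = n) (h' : j + i = n) (x : sections F i)
    (y : sections F j) :
    sectionsMul F h x y = (i * j).negOnePow • sectionsMul F h' y x := by
  refine Subtype.ext (funext fun m => ((F.obj m).mul_comm h h' _ _).trans ?_)
  rcases Int.even_or_odd (i * j) with e | e
  · rw [Int.negOnePow_even _ e, one_smul, one_smul]
    rfl
  · rw [Int.negOnePow_odd _ e, Units.neg_smul, Units.neg_smul, one_smul, one_smul]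
    rfl

/-- The limit of a diagram of graded commutative rings: in each degree, the compatible families of
elements. -/
def limitObj : GrCommRing.{u} where
  carrier i := sections F i
  one := ⟨fun j => (F.obj j).one, fun _ _ f => (F.map f).map_one⟩
  mul := sectionsMul F
  one_mul h x := Subtype.ext (funext fun j => (F.obj j).one_mul h _)
  mul_one h x := Subtype.ext (funext fun j => (F.obj j).mul_one h _)
  mul_assoc hij hn hjm hn' x y z :=
    Subtype.ext (funext fun j => (F.obj j).mul_assoc hij hn hjm hn' _ _ _)
  mul_comm := sectionsMul_comm F

/-- The limit cone of a diagram of graded commutative rings. -/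
def limitCone : Cone F where
  pt := limitObj F
  π :=
    { app j :=
        { app i := AddMonoidHom.mk' (fun x => x.1 j) fun _ _ => rfl
          map_one := rfl
          map_mul _ _ _ := rfl }
      naturality _ _ f := hom_ext fun _ x => (x.2 _ _ f).symm }

/-- The limit cone is a limit. -/
def limitConeIsLimit : IsLimit (limitCone F) where
  lift s :=
    { app i := AddMonoidHom.mk' (fun x => ⟨fun j => (s.π.app j).app i x, fun _ _ f =>
          congrArg (fun g : Hom _ _ => g.app i x) (s.w f)⟩)
        fun x y => Subtype.ext (funext fun j => map_add _ _ _)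
      map_one := Subtype.ext (funext fun j => (s.π.app j).map_one)
      map_mul h x y := Subtype.ext (funext fun j => (s.π.app j).map_mul h x y) }
  fac s j := rfl
  uniq s m hm := hom_ext fun i x => Subtype.ext (funext fun j =>
    congrArg (fun g : Hom _ _ => g.app i x) (hm j))

instance : HasLimits GrCommRing.{u} where
  has_limits_of_shape _ _ := ⟨fun F => ⟨⟨⟨_, limitConeIsLimit F⟩⟩⟩⟩

end Limits

end GrCommRing

/-! ### Pullbacks of graded algebras. -/

namespace GrAlg

variable (k : GrCommRing.{u})

instance : HasLimits (GrAlg k) := inferInstanceAs (HasLimits (StructuredArrow _ _))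
instance : HasColimits (GrAlg k) := inferInstance

variable {k} in
theorem hom_ext_app {A B : GrAlg k} {f g : A ⟶ B}
    (h : ∀ i x, f.right.app i x = g.right.app i x) : f = g :=
  Under.UnderMorphism.ext (GrCommRing.hom_ext h)

/-- Whether a square over `f` and `g` commutes depends only on the set `Z f g` of pairs of
homogeneous elements with equal images. Such sets form a small type, whatever the base. -/
theorem hasSmallPullbackFamilies : HasSmallPullbackFamilies (GrAlg k) := by
  intro A B
  let Z {X : GrAlg k} (f : A ⟶ X) (g : B ⟶ X) : Set (Σ n, A.right.carrier n × B.right.carrier n) :=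
    { z | f.right.app z.1 z.2.1 = g.right.app z.1 z.2.2 }
  have hZ {X P : GrAlg k} (f : A ⟶ X) (g : B ⟶ X) (p : P ⟶ A) (q : P ⟶ B) :
      p ≫ f = q ≫ g ↔ ∀ n x, ⟨n, p.right.app n x, q.right.app n x⟩ ∈ Z f g :=
    ⟨fun h n x => congrArg (fun t : P ⟶ X => t.right.app n x) h, fun h => hom_ext_app h⟩
  -- One cospan is chosen for each set that occurs; its pullback serves every other cospan with the
  -- same set.
  choose X f g h using fun z : { z // ∃ (X : GrAlg k) (f : A ⟶ X) (g : B ⟶ X), Z f g = z } => z.2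
  refine ⟨_, fun z => pullback (f z) (g z), fun z => pullback.fst _ _, fun z => pullback.snd _ _,
    fun {Y} f' g' => ?_⟩
  let z : { z // ∃ (X : GrAlg k) (f : A ⟶ X) (g : B ⟶ X), Z f g = z } := ⟨Z f' g', _, _, _, rfl⟩
  have hz {P : GrAlg k} (p : P ⟶ A) (q : P ⟶ B) : p ≫ f' = q ≫ g' ↔ p ≫ f z = q ≫ g z := by
    rw [hZ, hZ, h z]
  refine ⟨z, ⟨⟨(hz _ _).2 pullback.condition⟩, ⟨PullbackCone.IsLimit.mk _
    (fun s => pullback.lift s.fst s.snd ((hz _ _).1 s.condition)) ?_ ?_ ?_⟩⟩⟩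
  · exact fun s => pullback.lift_fst _ _ _
  · exact fun s => pullback.lift_snd _ _ _
  · exact fun s m h₁ h₂ => pullback.hom_ext (h₁.trans (pullback.lift_fst _ _ _).symm)
      (h₂.trans (pullback.lift_snd _ _ _).symm)

end GrAlg

/-! ### Module-valued functors, their subfunctors and products. -/

section ModFunctor

variable {C : Type (u + 1)} [Category.{u} C] {l : GrRing.{u}}

theorem map_comp_app (H : C ⥤ GrMod l) {X Y Z : C} (f : X ⟶ Y) (g : Y ⟶ Z) (n : ℤ)
    (x : (H.obj X).carrier n) :
    (H.map (f ≫ g)).app n x = (H.map g).app n ((H.map f).app n x) := by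
  rw [H.map_comp]
  rfl

theorem map_id_app (H : C ⥤ GrMod l) (X : C) (n : ℤ) (x : (H.obj X).carrier n) :
    (H.map (𝟙 X)).app n x = x := by
  rw [H.map_id]
  rfl

theorem naturality_app {H H' : C ⥤ GrMod l} (θ : H ⟶ H') {X Y : C} (f : X ⟶ Y) (n : ℤ)
    (x : (H.obj X).carrier n) :
    (θ.app Y).app n ((H.map f).app n x) = (H'.map f).app n ((θ.app X).app n x) :=
  congrArg (fun t : H.obj X ⟶ H'.obj Y => t.app n x) (θ.naturality f)

theorem modFunctor_hom_ext {H H' : C ⥤ GrMod l} {θ η : H ⟶ H'}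
    (h : ∀ A n x, (θ.app A).app n x = (η.app A).app n x) : θ = η :=
  NatTrans.ext (funext fun A => GrMod.hom_ext (h A))

/-- The set-valued functor of elements of degree `n` of a functor to graded modules. -/
def degreeFunctor (H : C ⥤ GrMod l) (n : ℤ) : C ⥤ Type u :=
  H ⋙ GrMod.toGrSet l ⋙ GradedObject.eval n

/-- A subfunctor, in graded submodules, of a functor to graded modules. -/
structure SubMod (H : C ⥤ GrMod l) where
  carrier : ∀ A n, AddSubgroup ((H.obj A).carrier n)
  act_mem : ∀ {A i j n} (h : i + j = n) (x : (H.obj A).carrier i) (a : l.carrier j),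
    x ∈ carrier A i → (H.obj A).act h x a ∈ carrier A n
  map_mem : ∀ {A B n} (f : A ⟶ B) (x : (H.obj A).carrier n),
    x ∈ carrier A n → (H.map f).app n x ∈ carrier B n

namespace SubMod

variable {H : C ⥤ GrMod l} (W : SubMod H)

/-- The functor underlying a subfunctor. -/
def functor : C ⥤ GrMod l where
  obj A :=
    { carrier n := W.carrier A n
      act h := AddMonoidHom.mk' (fun x => AddMonoidHom.mk'
          (fun a => ⟨(H.obj A).act h x.1 a, W.act_mem h x.1 a x.2⟩)
          fun a b => Subtype.ext (map_add ((H.obj A).act h x.1) a b))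
        fun x y => AddMonoidHom.ext fun a => Subtype.ext
          (congrArg (fun t => t a) (map_add ((H.obj A).act h) x.1 y.1))
      act_one h x := Subtype.ext ((H.obj A).act_one h x.1)
      act_mul hij hn hjm hn' x a b := Subtype.ext ((H.obj A).act_mul hij hn hjm hn' x.1 a b) }
  map {A B} f :=
    { app n := AddMonoidHom.mk' (fun x => ⟨(H.map f).app n x.1, W.map_mem f x.1 x.2⟩)
        fun x y => Subtype.ext (map_add ((H.map f).app n) x.1 y.1)
      map_act h x a := Subtype.ext ((H.map f).map_act h x.1 a) }
  map_id A := GrMod.hom_ext fun n x => Subtype.ext (map_id_app H A n x.1)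
  map_comp f g := GrMod.hom_ext fun n x => Subtype.ext (map_comp_app H f g n x.1)

/-- The inclusion of a subfunctor. -/
def ι : W.functor ⟶ H where
  app A :=
    { app n := (W.carrier A n).subtype
      map_act _ _ _ := rfl }

/-- Uniqueness of gluing is inherited from `H`; the only thing to ask is that an element glued from
two members of `W` lies in `W`. -/
theorem isLex (hH : ∀ n, IsLex (degreeFunctor H n))
    (h : ∀ {P X Y Z : C} {p : P ⟶ X} {q : P ⟶ Y} {f : X ⟶ Z} {g : Y ⟶ Z}, IsPullback p q f g →
      ∀ n (z : (H.obj P).carrier n), (H.map p).app n z ∈ W.carrier X n →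
        (H.map q).app n z ∈ W.carrier Y n → z ∈ W.carrier P n) (n : ℤ) :
    IsLex (degreeFunctor W.functor n) where
  terminal hX := ⟨⟨(0 : W.carrier _ n)⟩, ⟨fun x y => Subtype.ext
    (((hH n).terminal hX).2.elim x.1 y.1)⟩⟩
  exists_lift hp x y hxy := by
    obtain ⟨z, hz, hz'⟩ := (hH n).exists_lift hp x.1 y.1 (congrArg Subtype.val hxy)
    refine ⟨⟨z, h hp n z ?_ ?_⟩, Subtype.ext hz, Subtype.ext hz'⟩
    · exact (congrArg (· ∈ W.carrier _ n) hz).mpr x.2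
    · exact (congrArg (· ∈ W.carrier _ n) hz').mpr y.2
  ext hp z z' h h' := Subtype.ext ((hH n).ext hp z.1 z'.1 (congrArg Subtype.val h)
    (congrArg Subtype.val h'))

end SubMod

/-- The product of a family of functors to graded modules. -/
def piFunctor {ι : Type u} (H : ι → C ⥤ GrMod l) : C ⥤ GrMod l where
  obj A :=
    { carrier n := ∀ i, ((H i).obj A).carrier n
      act h := AddMonoidHom.mk' (fun x => AddMonoidHom.mk'
          (fun a i => ((H i).obj A).act h (x i) a)
          fun a b => funext fun i => map_add (((H i).obj A).act h (x i)) a b)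
        fun x y => AddMonoidHom.ext fun a => funext fun i =>
          congrArg (fun t => t a) (map_add (((H i).obj A).act h) (x i) (y i))
      act_one h x := funext fun i => ((H i).obj A).act_one h (x i)
      act_mul hij hn hjm hn' x a b :=
        funext fun i => ((H i).obj A).act_mul hij hn hjm hn' (x i) a b }
  map {A B} f :=
    { app n := AddMonoidHom.mk' (fun x i => ((H i).map f).app n (x i))
        fun x y => funext fun i => map_add (((H i).map f).app n) (x i) (y i)
      map_act h x a := funext fun i => ((H i).map f).map_act h (x i) a }
  map_id A := GrMod.hom_ext fun n x => funext fun i => map_id_app (H i) A n (x i)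
  map_comp f g := GrMod.hom_ext fun n x => funext fun i => map_comp_app (H i) f g n (x i)

/-- The projections of a product of functors to graded modules. -/
def piFunctorProj {ι : Type u} (H : ι → C ⥤ GrMod l) (i : ι) : piFunctor H ⟶ H i where
  app A :=
    { app n := Pi.evalAddMonoidHom _ i
      map_act _ _ _ := rfl }

theorem piFunctor_isLex {ι : Type u} (H : ι → C ⥤ GrMod l)
    (hH : ∀ i n, IsLex (degreeFunctor (H i) n)) (n : ℤ) :
    IsLex (degreeFunctor (piFunctor H) n) where
  terminal hX := ⟨⟨fun i => ((hH i n).terminal hX).1.some⟩, ⟨fun x y => funext fun i =>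
    ((hH i n).terminal hX).2.elim (x i) (y i)⟩⟩
  exists_lift hp x y hxy := by
    choose z hz hz' using fun i => (hH i n).exists_lift hp (x i) (y i) (congrFun hxy i)
    exact ⟨z, funext hz, funext hz'⟩
  ext hp z z' h h' := funext fun i => (hH i n).ext hp (z i) (z' i) (congrFun h i) (congrFun h' i)

end ModFunctor

/-! ### Formal expressions, their values, and the lex subfunctor they generate. -/

section Expressions

variable {C : Type (u + 1)} [Category.{u} C] (l : GrRing.{u}) {T : Type u} (r : T → C)
  (F : C ⥤ GradedObject ℤ (Type u))

/-- Formal expressions that describe elements of a graded module over the objects of a family, in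
terms of given generators. -/
inductive ModExpr : T → ℤ → Type u
  | gen {t n} (x : F.obj (r t) n) : ModExpr t n
  | zero (t n) : ModExpr t n
  | neg {t n} (e : ModExpr t n) : ModExpr t n
  | add {t n} (e e' : ModExpr t n) : ModExpr t n
  | act {t i j n} (h : i + j = n) (e : ModExpr t i) (a : l.carrier j) : ModExpr t n
  | map {t t' n} (f : r t ⟶ r t') (e : ModExpr t n) : ModExpr t' n
  | lift {s t t' n} (p : r s ⟶ r t) (q : r s ⟶ r t') (e : ModExpr t n) (e' : ModExpr t' n) :
    ModExpr s n

variable {l r F}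

namespace ModExpr

variable {H : C ⥤ GrMod l} (φ : F ⟶ H ⋙ GrMod.toGrSet l)

/-- The (partial, but single-valued on lex functors) evaluation of expressions. -/
def Ev : ∀ {t : T} {n : ℤ}, ModExpr l r F t n → (H.obj (r t)).carrier n → Prop
  | _, n, .gen x, u => u = φ.app _ n x
  | _, _, .zero _ _, u => u = 0
  | _, _, .neg e, u => ∃ v, Ev e v ∧ u = -v
  | _, _, .add e e', u => ∃ v v', Ev e v ∧ Ev e' v' ∧ u = v + v'
  | _, _, .act h e a, u => ∃ v, Ev e v ∧ u = (H.obj _).act h v a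
  | _, n, .map f e, u => ∃ v, Ev e v ∧ u = (H.map f).app n v
  | _, n, .lift p q e e', u =>
    -- The cospan is quantified here and not recorded in the expression: bases range over all of
    -- `C`, and recording them would make the type of expressions large.
    (∃ (X : C) (f : _ ⟶ X) (g : _ ⟶ X), IsPullback p q f g) ∧
      Ev e ((H.map p).app n u) ∧ Ev e' ((H.map q).app n u)

variable {φ}

theorem Ev.unique (hH : ∀ n, IsLex (degreeFunctor H n)) {t : T} {n : ℤ} {e : ModExpr l r F t n}
    {u v : (H.obj (r t)).carrier n} (hu : Ev φ e u) (hv : Ev φ e v) : u = v := by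
  induction e with
  | gen x => exact Eq.trans hu (Eq.symm hv)
  | zero => exact Eq.trans hu (Eq.symm hv)
  | neg e ih =>
    obtain ⟨u, hu, rfl⟩ := hu
    obtain ⟨v, hv, rfl⟩ := hv
    rw [ih hu hv]
  | add e e' ih ih' =>
    obtain ⟨u, u', hu, hu', rfl⟩ := hu
    obtain ⟨v, v', hv, hv', rfl⟩ := hv
    rw [ih hu hv, ih' hu' hv']
  | act h e a ih =>
    obtain ⟨u, hu, rfl⟩ := hu
    obtain ⟨v, hv, rfl⟩ := hv
    rw [ih hu hv]
  | map f e ih =>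
    obtain ⟨u, hu, rfl⟩ := hu
    obtain ⟨v, hv, rfl⟩ := hv
    rw [ih hu hv]
  | lift p q e e' ih ih' =>
    obtain ⟨⟨X, f, g, hp⟩, hu, hu'⟩ := hu
    exact (hH _).ext hp u v (ih hu hv.2.1) (ih' hu' hv.2.2)

theorem Ev.map_hom {H' : C ⥤ GrMod l} {φ' : F ⟶ H' ⋙ GrMod.toGrSet l} (θ : H ⟶ H')
    (hθ : ∀ A n x, (θ.app A).app n (φ.app A n x) = φ'.app A n x) {t : T} {n : ℤ}
    {e : ModExpr l r F t n} {u : (H.obj (r t)).carrier n} (hu : Ev φ e u) :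
    Ev φ' e ((θ.app (r t)).app n u) := by
  induction e with
  | gen x =>
    cases hu
    exact hθ _ _ _
  | zero =>
    cases hu
    exact map_zero _
  | neg e ih =>
    obtain ⟨u, hu, rfl⟩ := hu
    exact ⟨_, ih hu, map_neg _ _⟩
  | add e e' ih ih' =>
    obtain ⟨u, u', hu, hu', rfl⟩ := hu
    exact ⟨_, _, ih hu, ih' hu', map_add _ _ _⟩
  | act h e a ih =>
    obtain ⟨u, hu, rfl⟩ := hu
    exact ⟨_, ih hu, (θ.app _).map_act _ _ _⟩
  | map f e ih =>
    obtain ⟨u, hu, rfl⟩ := hu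
    exact ⟨_, ih hu, naturality_app θ f _ _⟩
  | lift p q e e' ih ih' =>
    refine ⟨hu.1, ?_, ?_⟩
    · rw [← naturality_app]
      exact ih hu.2.1
    · rw [← naturality_app]
      exact ih' hu.2.2

/-- Elements of two functors to graded modules are related if they are images of values of the same
expression. -/
def Rel {H H' : C ⥤ GrMod l} (φ : F ⟶ H ⋙ GrMod.toGrSet l) (φ' : F ⟶ H' ⋙ GrMod.toGrSet l)
    (r : T → C) (A : C) (n : ℤ) (x : (H.obj A).carrier n) (x' : (H'.obj A).carrier n) : Prop :=
  ∃ (t : T) (f : r t ⟶ A) (e : ModExpr l r F t n) (u : _) (u' : _),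
    Ev φ e u ∧ Ev φ' e u' ∧ (H.map f).app n u = x ∧ (H'.map f).app n u' = x'

namespace Rel

variable {H' : C ⥤ GrMod l} {φ' : F ⟶ H' ⋙ GrMod.toGrSet l} {A B : C} {n : ℤ}

theorem gen (x : F.obj A n) (hx : ∃ (t : T) (f : r t ⟶ A) (y : _), F.map f n y = x) :
    Rel φ φ' r A n (φ.app A n x) (φ'.app A n x) := by
  obtain ⟨t, f, y, rfl⟩ := hx
  refine ⟨t, f, .gen y, _, _, rfl, rfl, ?_, ?_⟩
  · exact (types_congr_hom (congrFun (φ.naturality f) n) y).symm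
  · exact (types_congr_hom (congrFun (φ'.naturality f) n) y).symm

theorem map (f : A ⟶ B) {x : (H.obj A).carrier n} {x' : (H'.obj A).carrier n}
    (h : Rel φ φ' r A n x x') : Rel φ φ' r B n ((H.map f).app n x) ((H'.map f).app n x') := by
  obtain ⟨t, g, e, u, u', hu, hu', rfl, rfl⟩ := h
  exact ⟨t, g ≫ f, e, u, u', hu, hu', map_comp_app _ _ _ _ _, map_comp_app _ _ _ _ _⟩

theorem neg {x : (H.obj A).carrier n} {x' : (H'.obj A).carrier n}
    (h : Rel φ φ' r A n x x') : Rel φ φ' r A n (-x) (-x') := by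
  obtain ⟨t, g, e, u, u', hu, hu', rfl, rfl⟩ := h
  exact ⟨t, g, .neg e, -u, -u', ⟨_, hu, rfl⟩, ⟨_, hu', rfl⟩, map_neg _ _, map_neg _ _⟩

theorem act {i j : ℤ} (hn : i + j = n) {x : (H.obj A).carrier i} {x' : (H'.obj A).carrier i}
    (a : l.carrier j) (h : Rel φ φ' r A i x x') :
    Rel φ φ' r A n ((H.obj A).act hn x a) ((H'.obj A).act hn x' a) := by
  obtain ⟨t, g, e, u, u', hu, hu', rfl, rfl⟩ := h
  exact ⟨t, g, .act hn e a, _, _, ⟨_, hu, rfl⟩, ⟨_, hu', rfl⟩, (H.map g).map_act _ _ _,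
    (H'.map g).map_act _ _ _⟩

theorem zero (hr : IsClosedFamily r) : Rel φ φ' r A n 0 0 := by
  obtain ⟨t, ⟨ht⟩⟩ := hr.initial
  exact ⟨t, ht.to A, .zero t n, 0, 0, rfl, rfl, map_zero _, map_zero _⟩

/-- The two summands may be described over different members of the family; both are moved to the
coproduct, which still maps to `A`. -/
theorem add (hr : IsClosedFamily r) {x y : (H.obj A).carrier n} {x' y' : (H'.obj A).carrier n}
    (h : Rel φ φ' r A n x x') (h' : Rel φ φ' r A n y y') :
    Rel φ φ' r A n (x + y) (x' + y') := by
  obtain ⟨t, f, e, u, u', hu, hu', rfl, rfl⟩ := h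
  obtain ⟨s, g, e', v, v', hv, hv', rfl, rfl⟩ := h'
  obtain ⟨m, i, j, ⟨hm⟩⟩ := hr.coprod t s
  obtain ⟨d, hd, hd'⟩ : ∃ d : r m ⟶ A, i ≫ d = f ∧ j ≫ d = g :=
    ⟨(BinaryCofan.IsColimit.desc' hm f g).1, (BinaryCofan.IsColimit.desc' hm f g).2⟩
  refine ⟨m, d, .add (.map i e) (.map j e'), _, _, ⟨_, _, ⟨_, hu, rfl⟩, ⟨_, hv, rfl⟩, rfl⟩,
    ⟨_, _, ⟨_, hu', rfl⟩, ⟨_, hv', rfl⟩, rfl⟩, ?_, ?_⟩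
  · rw [map_add, ← map_comp_app, ← map_comp_app, hd, hd']
  · rw [map_add, ← map_comp_app, ← map_comp_app, hd, hd']

/-- This makes maps out of the closure well defined. Two descriptions of `x` glue to one element
over a pullback, which is the value in `H` of a `lift` expression. By `h` that expression also has a
value in `H'`, and its two projections identify `x'` with `x''`. Only the existence of values is
transferred, not equations between them. -/
theorem unique (hr : IsClosedFamily r) (hH : ∀ n, IsLex (degreeFunctor H n))
    (hH' : ∀ n, IsLex (degreeFunctor H' n))
    (h : ∀ {t n} (e : ModExpr l r F t n) (u), Ev φ e u → ∃ u', Ev φ' e u')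
    {x : (H.obj A).carrier n} {x' x'' : (H'.obj A).carrier n} (h₁ : Rel φ φ' r A n x x')
    (h₂ : Rel φ φ' r A n x x'') : x' = x'' := by
  obtain ⟨t, f, e, u, u', hu, hu', hux, rfl⟩ := h₁
  obtain ⟨s, g, e', v, v', hv, hv', hvx, rfl⟩ := h₂
  obtain ⟨m, p, q, hp⟩ := hr.pullback f g
  obtain ⟨w, hw, hw'⟩ := (hH n).exists_lift hp u v (hux.trans hvx.symm)
  obtain ⟨w', hw₁, hw₂, hw₃⟩ := h (.lift p q e e') w
    ⟨⟨A, f, g, hp⟩, (congrArg (Ev φ e) hw).mpr hu, (congrArg (Ev φ e') hw').mpr hv⟩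
  rw [← hw₂.unique hH' hu', ← hw₃.unique hH' hv', ← map_comp_app, ← map_comp_app, hp.w]

end Rel

variable (φ) in
/-- The smallest lex subfunctor that contains the given generators. -/
def closure (hr : IsClosedFamily r) : SubMod H where
  carrier A n :=
    { carrier := { x | Rel φ φ r A n x x }
      zero_mem' := Rel.zero hr
      add_mem' := fun h h' => Rel.add hr h h'
      neg_mem' := fun h => Rel.neg h }
  act_mem h x a hx := Rel.act h a hx
  map_mem f x hx := Rel.map f hx

theorem closure_isLex (hr : IsClosedFamily r) (hH : ∀ n, IsLex (degreeFunctor H n)) (n : ℤ) :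
    IsLex (degreeFunctor (closure φ hr).functor n) := by
  refine SubMod.isLex _ hH (fun {P X Y Z p q f g} hp n z hz hz' => ?_) n
  obtain ⟨t, a, e, u, -, hu, -, hux, -⟩ := hz
  obtain ⟨s, b, e', v, -, hv, -, hvx, -⟩ := hz'
  -- `P` need not belong to the family, so the components are glued over a member that maps to `P`.
  -- The glued value is then carried to `z`.
  obtain ⟨m, p', q', hp'⟩ := hr.pullback (a ≫ f) (b ≫ g)
  obtain ⟨w, hw, hw'⟩ : ∃ w : (H.obj (r m)).carrier n,
      (H.map p').app n w = u ∧ (H.map q').app n w = v := (hH n).exists_lift hp' u v (by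
    change (H.map (a ≫ f)).app n u = (H.map (b ≫ g)).app n v
    rw [map_comp_app, map_comp_app, hux, hvx, ← map_comp_app, ← map_comp_app, hp.w])
  have hev : Ev φ (.lift p' q' e e') w :=
    ⟨⟨_, _, _, hp'⟩, by rwa [hw], by rwa [hw']⟩
  have key : (H.map (hp.lift (p' ≫ a) (q' ≫ b) (by simpa using hp'.w))).app n w = z := by
    refine (hH n).ext hp _ _ ?_ ?_
    · change (H.map p).app n _ = (H.map p).app n z
      rw [← map_comp_app, hp.lift_fst, map_comp_app, hw, hux]
    · change (H.map q).app n _ = (H.map q).app n z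
      rw [← map_comp_app, hp.lift_snd, map_comp_app, hw', hvx]
  exact ⟨m, _, .lift p' q' e e', w, w, hev, hev, key, key⟩

theorem mem_closure (hr : IsClosedFamily r) {t : T} {n : ℤ} {e : ModExpr l r F t n}
    {u : (H.obj (r t)).carrier n} (hu : Ev φ e u) : u ∈ (closure φ hr).carrier (r t) n :=
  ⟨t, 𝟙 _, e, u, u, hu, hu, map_id_app _ _ _ _, map_id_app _ _ _ _⟩

/-- All subexpressions also take values in the closure, so evaluation can be carried out inside it.
Hence a homomorphism out of the closure is determined by its effect on generators. -/
theorem Ev.restrict (hr : IsClosedFamily r)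
    {η : F ⟶ (closure φ hr).functor ⋙ GrMod.toGrSet l}
    (hη : ∀ A n x, ((closure φ hr).ι.app A).app n (η.app A n x) = φ.app A n x) {t : T} {n : ℤ}
    {e : ModExpr l r F t n} {u : (H.obj (r t)).carrier n} (hu : Ev φ e u) :
    Ev η e ⟨u, mem_closure hr hu⟩ := by
  induction e with
  | gen x => exact Subtype.ext (Eq.trans hu (hη _ _ _).symm)
  | zero => exact Subtype.ext hu
  | neg e ih =>
    obtain ⟨u, hu, rfl⟩ := hu
    exact ⟨_, ih hu, rfl⟩
  | add e e' ih ih' =>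
    obtain ⟨u, u', hu, hu', rfl⟩ := hu
    exact ⟨_, _, ih hu, ih' hu', rfl⟩
  | act h e a ih =>
    obtain ⟨u, hu, rfl⟩ := hu
    exact ⟨_, ih hu, rfl⟩
  | map f e ih =>
    obtain ⟨u, hu, rfl⟩ := hu
    exact ⟨_, ih hu, rfl⟩
  | lift p q e e' ih ih' => exact ⟨hu.1, ih hu.2.1, ih' hu.2.2⟩

/-- By construction every element of the closure is the image of one over a member of the small
family. -/
theorem closure_isSmallGen (hr : IsClosedFamily r) (n : ℤ) :
    IsSmallGen (degreeFunctor (closure φ hr).functor n) := by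
  refine ⟨Σ t, (closure φ hr).carrier (r t) n, fun s => r s.1, fun s => s.2, fun A a => ?_⟩
  obtain ⟨a, t, f, e, u, u', hu, -, hux, -⟩ := a
  exact ⟨⟨t, ⟨u, mem_closure hr hu⟩⟩, f, Subtype.ext hux⟩

end ModExpr

end Expressions

/-! ### The solution-set construction of initial arrows. -/

section Universal

variable {C : Type (u + 1)} [Category.{u} C] {l : GrRing.{u}}

/-- A functor to graded modules that is lex and small-generated in each degree. -/
structure IsFormalMod (H : C ⥤ GrMod l) : Prop where
  isLex : ∀ n, IsLex (degreeFunctor H n)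
  isSmallGen : ∀ n, IsSmallGen (degreeFunctor H n)

/-- The value at an element of a natural transformation to the underlying graded sets of a functor
to graded modules. -/
def elt {F : C ⥤ GradedObject ℤ (Type u)} {H : C ⥤ GrMod l} (φ : F ⟶ H ⋙ GrMod.toGrSet l) (A : C)
    (n : ℤ) (x : F.obj A n) : (H.obj A).carrier n :=
  φ.app A n x

theorem elt_map {F : C ⥤ GradedObject ℤ (Type u)} {H : C ⥤ GrMod l}
    (φ : F ⟶ H ⋙ GrMod.toGrSet l) {A B : C} (f : A ⟶ B) (n : ℤ) (x : F.obj A n) :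
    elt φ B n (F.map f n x) = (H.map f).app n (elt φ A n x) :=
  types_congr_hom (congrFun (φ.naturality f) n) x

open ModExpr in
/-- Every class of natural transformations from a small-generated functor to the underlying graded
sets of lex functors to graded modules has an initial arrow; it is separated by arrows of the class.
-/
theorem exists_initial_arrow [HasFiniteCoproducts C] (hC : HasSmallPullbackFamilies C)
    (F : C ⥤ GradedObject ℤ (Type u)) (hF : ∀ n, IsSmallGen (F ⋙ GradedObject.eval n))
    (P : ∀ H : C ⥤ GrMod l, (F ⟶ H ⋙ GrMod.toGrSet l) → Prop)
    (hP : ∀ H φ, P H φ → ∀ n, IsLex (degreeFunctor H n)) :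
    ∃ (I : C ⥤ GrMod l) (η : F ⟶ I ⋙ GrMod.toGrSet l), IsFormalMod I ∧
      (∀ H φ, P H φ → ∃! g : I ⟶ H, ∀ A n x, (g.app A).app n (elt η A n x) = elt φ A n x) ∧
      ∀ A n (x y : (I.obj A).carrier n),
        (∀ H φ, P H φ → ∀ g : I ⟶ H, (∀ A n x, (g.app A).app n (elt η A n x) = elt φ A n x) →
          (g.app A).app n x = (g.app A).app n y) → x = y := by
  choose S B b hb using hF
  -- A single closed family carries the generators of all degrees at once.
  obtain ⟨T, r, i, hr, hi⟩ := exists_isClosedFamily hC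
    (fun s : Σ n : ULift.{u} ℤ, S n.down => B s.1.down s.2)
  have hgen (A : C) (n : ℤ) (x : F.obj A n) : ∃ (t : T) (f : r t ⟶ A) (y : _), F.map f n y = x := by
    obtain ⟨s, f, hf⟩ := hb n A x
    obtain ⟨t, ht⟩ : ∃ t, r t = B n s := ⟨i ⟨⟨n⟩, s⟩, hi ⟨⟨n⟩, s⟩⟩
    refine ⟨t, eqToHom ht ≫ f, F.map (eqToHom ht.symm) n (b n s), ?_⟩
    rw [← hf]
    refine (types_congr_hom (congrFun (F.map_comp (eqToHom ht.symm) (eqToHom ht ≫ f)) n) _).symm.trans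
      ?_
    rw [eqToHom_trans_assoc, eqToHom_refl, Category.id_comp]
    rfl
  let E := Σ (t : T) (n : ULift.{u} ℤ), ModExpr l r F t n.down × ModExpr l r F t n.down
  let per (H : C ⥤ GrMod l) (φ : F ⟶ H ⋙ GrMod.toGrSet l) : Set E :=
    { z | ∃ u, Ev φ z.2.2.1 u ∧ Ev φ z.2.2.2 u }
  -- The class `P` may be proper, but it yields only a small type of subsets of `E`. One
  -- representative per subset makes the product `Q` small.
  let τ := { s : Set E // ∃ H φ, P H φ ∧ per H φ = s }
  choose K κ hK hper using fun s : τ => s.2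
  let Q := piFunctor K
  let ψ : F ⟶ Q ⋙ GrMod.toGrSet l :=
    { app A n := TypeCat.ofHom fun x s => (κ s).app A n x
      naturality A A' f := by
        refine funext fun n => ?_
        ext x
        exact funext fun s => types_congr_hom (congrFun ((κ s).naturality f) n) x }
  have hQ : ∀ n, IsLex (degreeFunctor Q n) := piFunctor_isLex K fun s => hP _ _ (hK s)
  let I := closure ψ hr
  let η : F ⟶ I.functor ⋙ GrMod.toGrSet l :=
    { app A n := TypeCat.ofHom fun x => ⟨ψ.app A n x, Rel.gen x (hgen A n x)⟩
      naturality A A' f := by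
        refine funext fun n => ?_
        ext x
        exact Subtype.ext (types_congr_hom (congrFun (ψ.naturality f) n) x) }
  have hI : IsFormalMod I.functor := ⟨closure_isLex hr hQ, closure_isSmallGen hr⟩
  -- expressions with a value in `Q` have one in every member of the class
  have hev {H φ} (h : P H φ) {t n} (e : ModExpr l r F t n) (u) (hu : Ev ψ e u) :
      ∃ u', Ev φ e u' := by
    -- The factor of `Q` with the same pattern as `φ` is used: the pair `(e, e)` belongs to the
    -- pattern exactly when `e` has a value.
    let s : τ := ⟨per H φ, H, φ, h, rfl⟩
    have h₁ : (⟨t, ⟨n⟩, e, e⟩ : E) ∈ per (K s) (κ s) :=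
      have := hu.map_hom (φ' := κ s) (piFunctorProj K s) fun _ _ _ => rfl
      ⟨_, this, this⟩
    rw [hper s] at h₁
    obtain ⟨u', h₂, -⟩ := h₁
    exact ⟨u', h₂⟩
  have hη {t n} (e : ModExpr l r F t n) (u) (hu : Ev ψ e u) : Ev η e ⟨u, mem_closure hr hu⟩ :=
    hu.restrict hr (fun _ _ _ => rfl)
  refine ⟨I.functor, η, hI, fun H φ h => ?_, fun A n x y hxy => ?_⟩
  -- The homomorphism to `H` has `Rel ψ φ` as its graph. Closure of `Rel` under the operations makes
  -- it linear and natural.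
  · have total (A n) (x : (I.functor.obj A).carrier n) : ∃ x', Rel ψ φ r A n x.1 x' := by
      obtain ⟨x, t, f, e, u, -, hu, -, rfl, -⟩ := x
      obtain ⟨u', hu'⟩ := hev h e u hu
      exact ⟨_, t, f, e, u, u', hu, hu', rfl, rfl⟩
    have uniq {A n} {x : (Q.obj A).carrier n} {x' x''} (h₁ : Rel ψ φ r A n x x')
        (h₂ : Rel ψ φ r A n x x'') : x' = x'' := Rel.unique hr hQ (hP H φ h) (hev h) h₁ h₂
    choose g hg using total
    refine ⟨{
      app A :=
        { app n := AddMonoidHom.mk' (g A n) fun x y =>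
            uniq (hg _ _ _) (Rel.add hr (hg A n x) (hg A n y))
          map_act hn x a := uniq (hg _ _ _) (Rel.act hn a (hg _ _ x)) }
      naturality A A' f := GrMod.hom_ext fun n x => uniq (hg _ _ _) (Rel.map f (hg _ _ x)) },
      fun A n x => uniq (hg _ _ _) (Rel.gen x (hgen A n x)), fun g' hg' => ?_⟩
    refine modFunctor_hom_ext fun A n x => ?_
    refine uniq ?_ (hg A n x)
    obtain ⟨x, t, f, e, u, -, hu, -, rfl, -⟩ := x
    refine ⟨t, f, e, u, _, hu, (hη e u hu).map_hom g' hg', rfl, ?_⟩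
    exact (naturality_app g' f n (⟨u, mem_closure hr hu⟩ : I.carrier (r t) n)).symm
  -- Each coordinate of `I` inside `Q` is an arrow to a member of the class, so the hypothesis gives
  -- equality coordinatewise.
  · refine Subtype.ext (funext fun s => ?_)
    exact hxy (K s) (κ s) (hK s) (I.ι ≫ piFunctorProj K s) fun _ _ _ => rfl

end Universal

theorem isRightAdjoint_of_exists_initial_arrow {C D : Type*} [Category C] [Category D] (G : D ⥤ C)
    (h : ∀ c : C, ∃ (d : D) (η : c ⟶ G.obj d), ∀ (d' : D) (f : c ⟶ G.obj d'),
      ∃! g : d ⟶ d', η ≫ G.map g = f) : G.IsRightAdjoint := by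
  have (c : C) : HasInitial (StructuredArrow c G) := by
    obtain ⟨d, η, hη⟩ := h c
    refine IsInitial.hasInitial (X := StructuredArrow.mk η) (IsInitial.ofUniqueHom
      (fun Y => StructuredArrow.homMk (hη Y.right Y.hom).choose (hη Y.right Y.hom).choose_spec.1)
      fun Y m => ?_)
    ext
    exact (hη Y.right Y.hom).choose_spec.2 m.right (StructuredArrow.w m)
  exact isRightAdjointOfStructuredArrowInitials G

/-! ### Left adjoints and colimits from initial arrows. -/

section Adjoints

variable {k : GrCommRing.{u}} {l : GrRing.{u}}

theorem FModSch.isFormalMod (F : FModSch k l) : IsFormalMod F.obj where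
  isLex n := (F.property n).isLex
  isSmallGen n := (F.property n).isSmallGen

theorem IsFormalMod.isFormalScheme {H : GrAlg k ⥤ GrMod l} (hH : IsFormalMod H) :
    isFormalScheme k (H ⋙ GrMod.toGrSet l) :=
  fun n => (hH.isLex n).isIndRepresentable (hH.isSmallGen n)

theorem FModSch.hom_ext_app {F G : FModSch k l} {f g : F ⟶ G}
    (h : ∀ A n x, (f.hom.app A).app n x = (g.hom.app A).app n x) : f = g :=
  ObjectProperty.hom_ext _ (modFunctor_hom_ext h)

theorem FSch.hom_ext_app {F G : FSch k} {f g : F ⟶ G}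
    (h : ∀ A n x, f.hom.app A n x = g.hom.app A n x) : f = g :=
  ObjectProperty.hom_ext _ (NatTrans.ext (funext fun A => funext fun n => by ext x; exact h A n x))

instance : (FModSch.forget k l).IsRightAdjoint := by
  refine isRightAdjoint_of_exists_initial_arrow _ fun F => ?_
  obtain ⟨I, η, hI, h, -⟩ := exists_initial_arrow (l := l) (GrAlg.hasSmallPullbackFamilies k) F.obj
    (fun n => (F.property n).isSmallGen) (fun H _ => IsFormalMod H) fun H _ hH => hH.isLex
  refine ⟨⟨I, hI.isFormalScheme⟩, ObjectProperty.homMk η, fun G f => ?_⟩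
  obtain ⟨g, hg, hg'⟩ := h G.obj f.hom G.isFormalMod
  exact ⟨ObjectProperty.homMk g, FSch.hom_ext_app hg,
    fun g' h' => ObjectProperty.hom_ext _ (hg' g'.hom fun A n x =>
      congrArg (fun t : F ⟶ _ => t.hom.app A n x) h')⟩

/-- Extension of scalars is the initial arrow for the class of additive transformations. The initial
arrow is itself additive because both sides of the equation agree in every target that separates
points. -/
instance : (FModSch.res k l).IsRightAdjoint := by
  refine isRightAdjoint_of_exists_initial_arrow _ fun F => ?_
  obtain ⟨I, η, hI, h, h'⟩ := exists_initial_arrow (l := l) (GrAlg.hasSmallPullbackFamilies k)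
    (F.obj ⋙ grAbForget) (fun n => (F.property n).isSmallGen)
    (fun H φ => IsFormalMod H ∧ ∀ A n (x y : F.obj.obj A n),
      elt φ A n (x + y) = elt φ A n x + elt φ A n y) fun H _ hH => hH.1.isLex
  have hη (A n) (x y : F.obj.obj A n) :
      elt η A n (x + y) = elt η A n x + elt η A n y := by
    refine h' A n _ _ fun H φ hφ g hg => ?_
    rw [map_add]
    exact (hg A n _).trans ((hφ.2 A n x y).trans
      (congrArg₂ (· + ·) (hg A n x).symm (hg A n y).symm))
  refine ⟨⟨I, hI.isFormalScheme⟩, ObjectProperty.homMk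
    { app A n := AddCommGrpCat.ofHom (AddMonoidHom.mk' (elt η A n) (hη A n))
      naturality A B f := by
        refine funext fun n => ?_
        ext x
        exact elt_map η f n x }, fun G f => ?_⟩
  obtain ⟨g, hg, hg'⟩ := h G.obj (Functor.whiskerRight f.hom grAbForget)
    ⟨G.isFormalMod, fun A n x y => map_add (f.hom.app A n).hom x y⟩
  refine ⟨ObjectProperty.homMk g, ?_, fun g' h' => ObjectProperty.hom_ext _ (hg' g'.hom
    fun A n x => congrArg (fun t : F ⟶ _ => t.hom.app A n x) h')⟩
  refine ObjectProperty.hom_ext _ (NatTrans.ext (funext fun A => funext fun n => ?_))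
  ext x
  exact hg A n x

/-- A colimit is the initial arrow from the disjoint union of the underlying sets of the diagram,
for the class of transformations that are linear on each summand and compatible with the diagram.
Both properties pass to the initial arrow by separation. -/
instance : HasColimitsOfSize.{u, u} (FModSch k l) := by
  refine ⟨fun J _ => ⟨fun K => ?_⟩⟩
  let F : GrAlg k ⥤ GradedObject ℤ (Type u) :=
    { obj A n := Σ j, ((K.obj j).obj.obj A).carrier n
      map f n := TypeCat.ofHom fun x => ⟨x.1, ((K.obj x.1).obj.map f).app n x.2⟩
      map_id A := by
        refine funext fun n => ?_
        refine ConcreteCategory.hom_ext _ _ fun x => ?_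
        exact congrArg (Sigma.mk (β := fun j => ((K.obj j).obj.obj A).carrier n) x.1)
          (map_id_app (K.obj x.1).obj A n x.2)
      map_comp f g := by
        refine funext fun n => ?_
        refine ConcreteCategory.hom_ext _ _ fun x => ?_
        exact congrArg (Sigma.mk (β := fun j => ((K.obj j).obj.obj _).carrier n) x.1)
          (map_comp_app (K.obj x.1).obj f g n x.2) }
  have hF (n : ℤ) : IsSmallGen (F ⋙ GradedObject.eval n) := by
    choose S B b hb using fun j => (K.obj j).isFormalMod.isSmallGen n
    refine ⟨Σ j, S j, fun s => B s.1 s.2, fun s => ⟨s.1, b s.1 s.2⟩, fun A a => ?_⟩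
    obtain ⟨s, f, hf⟩ := hb a.1 A a.2
    exact ⟨⟨a.1, s⟩, f, congrArg (Sigma.mk a.1) hf⟩
  let P (H : GrAlg k ⥤ GrMod l) (φ : F ⟶ H ⋙ GrMod.toGrSet l) : Prop := IsFormalMod H ∧
    ∃ c : ∀ j, (K.obj j).obj ⟶ H, (∀ j A n x, ((c j).app A).app n x = elt φ A n ⟨j, x⟩) ∧
      ∀ j j' (f : j ⟶ j'), (K.map f).hom ≫ c j' = c j
  obtain ⟨I, η, hI, h, h'⟩ := exists_initial_arrow (l := l) (GrAlg.hasSmallPullbackFamilies k)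
    F hF P fun H _ hH => hH.1.isLex
  let c (j : J) : (K.obj j).obj ⟶ I :=
    { app A :=
        { app n := AddMonoidHom.mk' (fun x => elt η A n ⟨j, x⟩) fun x y => by
            refine h' A n _ _ fun H φ ⟨_, c, hc, _⟩ g hg => ?_
            rw [map_add, hg, hg, hg, ← hc, ← hc, ← hc, map_add]
          map_act {i m n} hn x a := by
            refine h' A n _ _ fun H φ ⟨_, c, hc, _⟩ g hg => ?_
            refine Eq.trans ?_ ((g.app A).map_act hn _ a).symm
            refine (hg A n _).trans (Eq.trans ?_ (congrArg (fun t => (H.obj A).act hn t a)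
              (hg A i _).symm))
            rw [← hc, ← hc]
            exact ((c j).app A).map_act hn x a }
      naturality A B f := GrMod.hom_ext fun n x =>
        elt_map η f n ⟨j, x⟩ }
  let s : Cocone K :=
    { pt := ⟨I, hI.isFormalScheme⟩
      ι :=
        { app j := ObjectProperty.homMk (c j)
          naturality j j' f := by
            refine FModSch.hom_ext_app fun A n x => ?_
            refine h' A n _ _ fun H φ ⟨_, c, hc, hc'⟩ g hg => ?_
            refine (hg A n _).trans (Eq.trans ?_ (hg A n _).symm)
            rw [← hc, ← hc]
            exact congrArg (fun t : _ ⟶ H => (t.app A).app n x) (hc' j j' f) } }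
  choose d hd hd' using fun s : Cocone K => h s.pt.obj
    { app A n := TypeCat.ofHom fun x => ((s.ι.app x.1).hom.app A).app n x.2
      naturality A B f := by
        refine funext fun n => ?_
        ext x
        exact naturality_app (s.ι.app x.1).hom f n x.2 }
    ⟨s.pt.isFormalMod, fun j => (s.ι.app j).hom, fun _ _ _ _ => rfl,
      fun j j' f => congrArg (fun t => t.hom) (s.w f)⟩
  exact ⟨⟨⟨s, {
    desc s := ObjectProperty.homMk (d s)
    fac s j := FModSch.hom_ext_app fun A n x => hd s A n ⟨j, x⟩
    uniq s m hm := ObjectProperty.hom_ext _ (hd' s m.hom fun A n x =>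
      congrArg (fun t => (t.hom.app A).app n x.2) (hm x.1)) }⟩⟩⟩

end Adjoints

/-! ### Limits of formal module schemes. -/

theorem isIndObject_of_isLimit {C : Type*} [Category.{u} C] [HasLimits C] {J : Type u}
    [SmallCategory J] {K : J ⥤ Cᵒᵖ ⥤ Type u} {c : Cone K} (hc : IsLimit c)
    (h : ∀ j, IsIndObject (K.obj j)) : IsIndObject c.pt := by
  -- The diagram lifts to ind-objects, where limits exist and are preserved by the inclusion into
  -- presheaves.
  let K' : J ⥤ Ind C := ObjectProperty.lift _ K h ⋙ (Ind.equivalence C).inverse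
  let e : K' ⋙ Ind.inclusion C ≅ K :=
    Functor.isoWhiskerLeft (ObjectProperty.lift _ K h)
      (Functor.isoWhiskerRight (Ind.equivalence C).counitIso (ObjectProperty.ι _))
  exact (Ind.isIndObject_inclusion_obj (limit K')).map
    (IsLimit.conePointsIsoOfNatIso (isLimitOfPreserves (Ind.inclusion C) (limit.isLimit K'))
      hc e).hom

namespace GrMod

section Limits

variable {l : GrRing.{u}} {J : Type u} [SmallCategory J] (F : J ⥤ GrMod l)

/-- The compatible families of elements of degree `i`. -/
def sections (i : ℤ) : AddSubgroup (∀ j, (F.obj j).carrier i) where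
  carrier := { x | ∀ (j j' : J) (f : j ⟶ j'), (F.map f).app i (x j) = x j' }
  zero_mem' := by intro j j' f; simp
  add_mem' := fun hx hy j j' f => by simp [hx j j' f, hy j j' f]
  neg_mem' := fun hx j j' f => by simp [hx j j' f]

/-- The limit of a diagram of graded modules: in each degree, the compatible families of elements.
-/
def limitObj : GrMod l where
  carrier i := sections F i
  act h := AddMonoidHom.mk' (fun x => AddMonoidHom.mk' (fun a =>
      ⟨fun j => (F.obj j).act h (x.1 j) a, fun _ _ f => by rw [(F.map f).map_act, x.2 _ _ f]⟩)
      fun a b => Subtype.ext (funext fun j => map_add _ _ _))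
      fun x y => AddMonoidHom.ext fun a => Subtype.ext (funext fun j =>
        congrArg (fun t => t a) (map_add ((F.obj j).act h) (x.1 j) (y.1 j)))
  act_one h x := Subtype.ext (funext fun j => (F.obj j).act_one h _)
  act_mul hij hn hjm hn' x a b :=
    Subtype.ext (funext fun j => (F.obj j).act_mul hij hn hjm hn' _ _ _)

/-- The limit cone of a diagram of graded modules. -/
def limitCone : Cone F where
  pt := limitObj F
  π :=
    { app j :=
        { app i := AddMonoidHom.mk' (fun x => x.1 j) fun _ _ => rfl
          map_act _ _ _ := rfl }
      naturality _ _ f := hom_ext fun _ x => (x.2 _ _ f).symm }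

/-- The limit cone is a limit. -/
def limitConeIsLimit : IsLimit (limitCone F) where
  lift s :=
    { app i := AddMonoidHom.mk' (fun x => ⟨fun j => (s.π.app j).app i x, fun _ _ f =>
          congrArg (fun g : Hom _ _ => g.app i x) (s.w f)⟩)
        fun x y => Subtype.ext (funext fun j => map_add _ _ _)
      map_act h x y := Subtype.ext (funext fun j => (s.π.app j).map_act h x y) }
  fac s j := rfl
  uniq s m hm := hom_ext fun i x => Subtype.ext (funext fun j =>
    congrArg (fun g : Hom _ _ => g.app i x) (hm j))

instance : HasLimits (GrMod l) where
  has_limits_of_shape _ _ := ⟨fun F => ⟨⟨⟨_, limitConeIsLimit F⟩⟩⟩⟩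

/-- Limits of graded modules are limits of sets in each degree. -/
def isLimitMapCone (n : ℤ) :
    IsLimit ((toGrSet l ⋙ GradedObject.eval n).mapCone (limitCone F)) where
  lift s := TypeCat.ofHom fun x => ⟨fun j => s.π.app j x, fun _ _ f => types_congr_hom (s.w f) x⟩
  fac s j := rfl
  uniq s m hm := ConcreteCategory.hom_ext _ _ fun x => Subtype.ext (funext fun j =>
    types_congr_hom (hm j) x)

instance (n : ℤ) : PreservesLimitsOfSize.{u, u} (toGrSet l ⋙ GradedObject.eval n) where
  preservesLimitsOfShape :=
    ⟨fun {F} => preservesLimit_of_preserves_limit_cone (limitConeIsLimit F) (isLimitMapCone F n)⟩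

end Limits

end GrMod

section

variable {k : GrCommRing.{u}} {l : GrRing.{u}}

variable (k l) in
/-- The presheaf on opposite algebras of elements of degree `q`. -/
def degreePresheaf (q : ℤ) : (GrAlg k ⥤ GrMod l) ⥤ (GrAlg k)ᵒᵖᵒᵖ ⥤ Type u :=
  (Functor.whiskeringRight (GrAlg k) _ _).obj (GrMod.toGrSet l ⋙ GradedObject.eval q) ⋙
    (Functor.whiskeringLeft _ _ _).obj (unopUnop (GrAlg k))

instance (q : ℤ) : PreservesLimitsOfSize.{u, u} (degreePresheaf k l q) :=
  inferInstanceAs (PreservesLimitsOfSize.{u, u} (_ ⋙ _))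

instance : ObjectProperty.IsClosedUnderIsomorphisms (fun F : GrAlg k ⥤ GrMod l =>
    isFormalScheme k (F ⋙ GrMod.toGrSet l)) where
  of_iso e hF q := ObjectProperty.prop_of_iso IsIndObject ((degreePresheaf k l q).mapIso e) (hF q)

instance (J : Type u) [SmallCategory J] : ObjectProperty.IsClosedUnderLimitsOfShape
    (fun F : GrAlg k ⥤ GrMod l => isFormalScheme k (F ⋙ GrMod.toGrSet l)) J := .mk' (by
  rintro _ ⟨F, hF⟩ q
  exact isIndObject_of_isLimit (isLimitOfPreserves (degreePresheaf k l q) (limit.isLimit F))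
    fun j => hF j q)

instance : HasLimitsOfSize.{u, u} (FModSch k l) := ⟨fun _ _ => inferInstance⟩

end

/-! ### Module structures on split quotients. -/

/-- The abelian group structure on a quotient of an abelian group, with a chosen section of the
projection, along a congruence. -/
abbrev addCommGroupOfSection {M Z : Type u} [AddCommGroup M] (π : M → Z) (s : Z → M)
    (hs : ∀ z, π (s z) = z) (hadd : ∀ x y, π (x + y) = π (s (π x) + y)) : AddCommGroup Z :=
  have hadd' (x y) : π (x + y) = π (x + s (π y)) := by
    rw [add_comm, hadd, add_comm]
  { add z w := π (s z + s w)
    zero := π 0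
    neg z := π (-s z)
    nsmul := @nsmulRec _ ⟨π 0⟩ ⟨fun z w => π (s z + s w)⟩
    zsmul := @zsmulRec _ ⟨π 0⟩ ⟨fun z w => π (s z + s w)⟩ ⟨fun z => π (-s z)⟩
      (@nsmulRec _ ⟨π 0⟩ ⟨fun z w => π (s z + s w)⟩)
    add_assoc a b c := by
      change π (s (π (s a + s b)) + s c) = π (s a + s (π (s b + s c)))
      rw [← hadd, ← hadd', add_assoc]
    add_comm a b := congrArg π (add_comm _ _)
    zero_add a := by
      change π (s (π 0) + s a) = a
      rw [← hadd, zero_add, hs]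
    add_zero a := by
      change π (s a + s (π 0)) = a
      rw [← hadd', add_zero, hs]
    neg_add_cancel a := by
      change π (s (π (-s a)) + s a) = π 0
      rw [← hadd, neg_add_cancel] }

namespace GrMod

variable {l : GrRing.{u}}

/-- The graded module structure on a graded set that is a quotient of a graded module, with a
chosen section of the projection, along a congruence. -/
def ofSection (M : GrMod l) {Z : ℤ → Type u} (π : ∀ n, M.carrier n → Z n)
    (s : ∀ n, Z n → M.carrier n) (hs : ∀ n z, π n (s n z) = z)
    (hadd : ∀ n x y, π n (x + y) = π n (s n (π n x) + y))
    (hact : ∀ {i j n} (h : i + j = n) x (a : l.carrier j),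
      π n (M.act h x a) = π n (M.act h (s i (π i x)) a)) : GrMod l :=
  have hadd' (n x y) : π n (x + y) = π n (s n (π n x) + s n (π n y)) := by
    rw [hadd, add_comm, hadd, add_comm]
  letI (n : ℤ) : AddCommGroup (Z n) := addCommGroupOfSection (π n) (s n) (hs n) (hadd n)
  { carrier := Z
    act {i j n} h := AddMonoidHom.mk' (fun z => AddMonoidHom.mk' (fun a => π n (M.act h (s i z) a))
        fun a b => by
          rw [map_add]
          exact hadd' n _ _)
      fun z w => AddMonoidHom.ext fun a => by
        change π n (M.act h (s i (π i (s i z + s i w))) a) = _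
        rw [← hact, map_add]
        exact hadd' n _ _
    act_one h z := by
      change π _ (M.act h (s _ z) l.one) = z
      rw [M.act_one, hs]
    act_mul hij hn hjm hn' z a b := by
      change π _ (M.act hn (s _ (π _ (M.act hij (s _ z) a))) b) =
        π _ (M.act hn' (s _ z) (l.mul hjm a b))
      rw [← hact, M.act_mul hij hn hjm hn'] }

end GrMod

section Quotient

variable {C : Type (u + 1)} [Category.{u} C] {l : GrRing.{u}}

/-- A split coequalizer, on underlying graded sets, of two natural transformations of functors to
graded modules. -/
structure SplitPair {A B : C ⥤ GrMod l} (f g : A ⟶ B) (Z : C ⥤ GradedObject ℤ (Type u)) where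
  π : B ⋙ GrMod.toGrSet l ⟶ Z
  s : Z ⟶ B ⋙ GrMod.toGrSet l
  t : B ⋙ GrMod.toGrSet l ⟶ A ⋙ GrMod.toGrSet l
  condition : Functor.whiskerRight f _ ≫ π = Functor.whiskerRight g _ ≫ π
  s_π : s ≫ π = 𝟙 Z
  t_g : t ≫ Functor.whiskerRight g _ = 𝟙 _
  t_f : t ≫ Functor.whiskerRight f _ = π ≫ s

namespace SplitPair

variable {A B : C ⥤ GrMod l} {f g : A ⟶ B} {Z : C ⥤ GradedObject ℤ (Type u)} (S : SplitPair f g Z)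

/-- The projection, on elements. -/
def proj (X : C) (n : ℤ) (x : (B.obj X).carrier n) : Z.obj X n := S.π.app X n x

theorem proj_eq (X : C) (n : ℤ) (a : (A.obj X).carrier n) :
    S.proj X n ((f.app X).app n a) = S.proj X n ((g.app X).app n a) :=
  congrArg (fun t => t.app X n a) S.condition

theorem proj_section (X : C) (n : ℤ) (z : Z.obj X n) : S.proj X n (elt S.s X n z) = z :=
  congrArg (fun t => t.app X n z) S.s_π

theorem g_left (X : C) (n : ℤ) (x : (B.obj X).carrier n) :
    (g.app X).app n (elt S.t X n x) = x :=
  congrArg (fun t => t.app X n x) S.t_g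

theorem f_left (X : C) (n : ℤ) (x : (B.obj X).carrier n) :
    (f.app X).app n (elt S.t X n x) = elt S.s X n (S.proj X n x) :=
  congrArg (fun t => t.app X n x) S.t_f

theorem proj_map {X Y : C} (h : X ⟶ Y) (n : ℤ) (x : (B.obj X).carrier n) :
    S.proj Y n ((B.map h).app n x) = Z.map h n (S.proj X n x) :=
  types_congr_hom (congrFun (S.π.naturality h) n) x

/-- The fibres of the projection form a congruence: `x` is the image under `g`, and its normal form
`s (π x)` the image under `f`, of one element `t x`. Both maps are additive and `π` identifies them.
-/
theorem proj_add_proj (X : C) (n : ℤ) (x y : (B.obj X).carrier n) :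
    S.proj X n (x + y) = S.proj X n (elt S.s X n (S.proj X n x) + elt S.s X n (S.proj X n y)) := by
  rw [← S.f_left, ← S.f_left, ← map_add, S.proj_eq, map_add, S.g_left, S.g_left]

theorem proj_add (X : C) (n : ℤ) (x y : (B.obj X).carrier n) :
    S.proj X n (x + y) = S.proj X n (elt S.s X n (S.proj X n x) + y) := by
  rw [proj_add_proj, S.proj_add_proj X n (elt S.s X n _) y, S.proj_section]

theorem proj_act (X : C) {i j n : ℤ} (h : i + j = n) (x : (B.obj X).carrier i) (a : l.carrier j) :
    S.proj X n ((B.obj X).act h x a) =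
      S.proj X n ((B.obj X).act h (elt S.s X i (S.proj X i x)) a) := by
  rw [← S.f_left, ← (f.app X).map_act, S.proj_eq, (g.app X).map_act, S.g_left]

theorem map_proj_add {X Y : C} (h : X ⟶ Y) (n : ℤ) (z w : Z.obj X n) :
    Z.map h n (S.proj X n (elt S.s X n z + elt S.s X n w)) =
      S.proj Y n (elt S.s Y n (Z.map h n z) + elt S.s Y n (Z.map h n w)) := by
  rw [elt_map, elt_map, ← map_add, proj_map]

theorem map_proj_act {X Y : C} (h : X ⟶ Y) {i j n : ℤ} (hn : i + j = n) (z : Z.obj X i)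
    (a : l.carrier j) :
    Z.map h n (S.proj X n ((B.obj X).act hn (elt S.s X i z) a)) =
      S.proj Y n ((B.obj Y).act hn (elt S.s Y i (Z.map h i z)) a) := by
  rw [elt_map, ← (B.map h).map_act, proj_map]

/-- The quotient of a functor to graded modules. -/
def functor : C ⥤ GrMod l where
  obj X := GrMod.ofSection (B.obj X) (S.proj X) (elt S.s X) (S.proj_section X) (S.proj_add X)
    (S.proj_act X)
  map {X Y} h :=
    { app n := AddMonoidHom.mk' (fun z => Z.map h n z) (S.map_proj_add h n)
      map_act hn z a := S.map_proj_act h hn z a }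
  map_id X := GrMod.hom_ext fun n z => congrArg (fun t => t n z) (Z.map_id X)
  map_comp h h' := GrMod.hom_ext fun n z => congrArg (fun t => t n z) (Z.map_comp h h')

/-- The projection to the quotient of a functor to graded modules. -/
def toFunctor : B ⟶ S.functor where
  app X :=
    { app n := AddMonoidHom.mk' (S.proj X n) (S.proj_add_proj X n)
      map_act hn x a := S.proj_act X hn x a }
  naturality X Y h := GrMod.hom_ext fun n x => S.proj_map h n x

theorem w : f ≫ S.toFunctor = g ≫ S.toFunctor :=
  modFunctor_hom_ext fun X n a => S.proj_eq X n a

/-- A map that coequalizes `f` and `g` cannot distinguish `x` from its normal form, so composing it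
with the section gives a linear map on the quotient. -/
theorem apply_section {K : C ⥤ GrMod l} (h : B ⟶ K) (hh : f ≫ h = g ≫ h) (X : C) (n : ℤ)
    (x : (B.obj X).carrier n) :
    (h.app X).app n (elt S.s X n (S.proj X n x)) = (h.app X).app n x := by
  rw [← S.f_left]
  refine (congrArg (fun t => (t.app X).app n (elt S.t X n x)) hh).trans ?_
  exact congrArg ((h.app X).app n) (S.g_left X n x)

/-- The homomorphism out of the quotient of a functor to graded modules. -/
def desc {K : C ⥤ GrMod l} (h : B ⟶ K) (hh : f ≫ h = g ≫ h) : S.functor ⟶ K where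
  app X :=
    { app n := AddMonoidHom.mk' (fun z => (h.app X).app n (elt S.s X n z)) fun z w =>
        (S.apply_section h hh X n _).trans (map_add ((h.app X).app n) _ _)
      map_act {i j n} hn z a := (S.apply_section h hh X n _).trans
        ((h.app X).map_act hn (elt S.s X i z) a) }
  naturality X Y t := GrMod.hom_ext fun n z =>
    (congrArg ((h.app Y).app n) (elt_map S.s t n z)).trans (naturality_app h t n _)

end SplitPair

end Quotient

/-! ### Monadicity over formal schemes. -/

section Monadic

variable {k : GrCommRing.{u}} {l : GrRing.{u}} {A B : FModSch k l} {f g : A ⟶ B}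

/-- A split coequalizer of formal schemes, as one of functors. -/
def IsSplitCoequalizer.splitPair {Z : FSch k} {π : (FModSch.forget k l).obj B ⟶ Z}
    (q : IsSplitCoequalizer ((FModSch.forget k l).map f) ((FModSch.forget k l).map g) π) :
    SplitPair f.hom g.hom Z.obj where
  π := π.hom
  s := q.rightSection.hom
  t := q.leftSection.hom
  condition := congrArg (·.hom) q.condition
  s_π := congrArg (·.hom) q.rightSection_π
  t_g := congrArg (·.hom) q.leftSection_bottom
  t_f := congrArg (·.hom) q.leftSection_top

/-- The underlying functor of the quotient is the given scheme `Z` itself, so ind-representability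
is inherited and the forgetful functor sends the coequalizer to the given split one. -/
theorem exists_isColimit_cofork_of_isSplitPair [(FModSch.forget k l).IsSplitPair f g] :
    ∃ (Z : FModSch k l) (π : B ⟶ Z) (w : f ≫ π = g ≫ π),
      Nonempty (IsColimit (Cofork.ofπ π w)) ∧ Nonempty (IsSplitCoequalizer
        ((FModSch.forget k l).map f) ((FModSch.forget k l).map g) ((FModSch.forget k l).map π)) := by
  obtain ⟨Z, π, ⟨q⟩⟩ := HasSplitCoequalizer.splittable (f := (FModSch.forget k l).map f)
    (g := (FModSch.forget k l).map g)
  let S := IsSplitCoequalizer.splitPair q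
  refine ⟨⟨S.functor, Z.property⟩, ObjectProperty.homMk S.toFunctor,
    ObjectProperty.hom_ext _ S.w, ⟨Cofork.IsColimit.mk _
      (fun s => ObjectProperty.homMk (S.desc s.π.hom (congrArg (·.hom) s.condition))) (fun s => ?_)
      fun s m hm => ?_⟩, ⟨q⟩⟩
  · exact FModSch.hom_ext_app fun X n x => S.apply_section s.π.hom (congrArg (·.hom) s.condition) X n x
  · refine FModSch.hom_ext_app fun X n z => ?_
    refine Eq.trans ?_ (congrArg (fun t => (t.hom.app X).app n (elt S.s X n z)) hm)
    exact congrArg ((m.hom.app X).app n) (S.proj_section X n z).symm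

instance : Monad.HasCoequalizerOfIsSplitPair (FModSch.forget k l) where
  out f g _ := by
    obtain ⟨Z, π, w, ⟨h⟩, -⟩ := exists_isColimit_cofork_of_isSplitPair (f := f) (g := g)
    exact ⟨⟨⟨_, h⟩⟩⟩

instance : Monad.PreservesColimitOfIsSplitPair (FModSch.forget k l) where
  out f g _ := by
    obtain ⟨Z, π, w, ⟨h⟩, ⟨q⟩⟩ := exists_isColimit_cofork_of_isSplitPair (f := f) (g := g)
    exact preservesColimit_of_preserves_colimit_cocone h
      ((isColimitMapCoconeCoforkEquiv (FModSch.forget k l) w).symm q.isCoequalizer)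

instance : (FModSch.forget k l).ReflectsIsomorphisms where
  reflects {A B} f hf := by
    let g := inv ((FModSch.forget k l).map f)
    have hfg (X n) (x : (B.obj.obj X).carrier n) :
        (f.hom.app X).app n (elt (H := A.obj) g.hom X n x) = x :=
      congrArg (fun t : (FModSch.forget k l).obj B ⟶ _ => t.hom.app X n x)
        (IsIso.inv_hom_id ((FModSch.forget k l).map f))
    have hgf (X n) (x : (A.obj.obj X).carrier n) :
        elt (H := A.obj) g.hom X n ((f.hom.app X).app n x) = x :=
      congrArg (fun t : (FModSch.forget k l).obj A ⟶ _ => t.hom.app X n x)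
        (IsIso.hom_inv_id ((FModSch.forget k l).map f))
    have hinj (X n) : Function.Injective ((f.hom.app X).app n) :=
      Function.LeftInverse.injective (hgf X n)
    refine ⟨ObjectProperty.homMk {
      app X :=
        { app n := AddMonoidHom.mk' (elt (H := A.obj) g.hom X n) fun x y => hinj X n (by
            rw [map_add, hfg, hfg, hfg])
          map_act {i j n} hn x a := hinj X n ((hfg X n _).trans (Eq.trans
            (congrArg (fun t => (B.obj.obj X).act hn t a) (hfg X i x).symm)
            ((f.hom.app X).map_act hn _ a).symm)) }
      naturality X Y h := GrMod.hom_ext fun n x => elt_map (H := A.obj) g.hom h n x },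
      FModSch.hom_ext_app hgf, FModSch.hom_ext_app hfg⟩

theorem FModSch.isEquivalence_comparison {L : FSch k ⥤ FModSch k l}
    (adj : L ⊣ FModSch.forget k l) : (Monad.comparison adj).IsEquivalence :=
  (Monad.monadicOfHasPreservesGSplitCoequalizersOfReflectsIsomorphisms adj).eqv

end Monadic

/-! ### Formal group schemes as modules over the integers in degree zero. -/

/-- The elements of degree `i` of the ring of integers, placed in degree zero. -/
def intPart (i : ℤ) : AddSubgroup (ULift.{u} ℤ) where
  carrier := { x | i ≠ 0 → x = 0 }
  zero_mem' := fun _ => rfl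
  add_mem' := fun hx hy hi => by rw [hx hi, hy hi, add_zero]
  neg_mem' := fun hx hi => by rw [hx hi, neg_zero]

/-- The product of integers placed in degree zero. -/
def intMul {i j n : ℤ} (h : i + j = n) : intPart.{u} i →+ intPart.{u} j →+ intPart.{u} n :=
  AddMonoidHom.mk' (fun x => AddMonoidHom.mk' (fun y => ⟨x.1 * y.1, fun hn => by
      by_cases hi : i = 0
      · rw [y.2 (by omega), mul_zero]
      · rw [x.2 hi, zero_mul]⟩)
    fun y z => Subtype.ext (mul_add _ _ _)) fun x y => AddMonoidHom.ext fun z =>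
      Subtype.ext (add_mul _ _ _)

/-- The ring of integers as a graded ring placed in degree zero. -/
def intGr : GrRing.{u} where
  carrier i := intPart i
  one := ⟨1, fun h => (h rfl).elim⟩
  mul := intMul
  one_mul h a := Subtype.ext (one_mul _)
  mul_one h a := Subtype.ext (mul_one _)
  mul_assoc hij hn hjm hn' a b c := Subtype.ext (mul_assoc _ _ _)

/-- The transport of a family of abelian groups along an equality of indices. -/
def castHom {M : ℤ → Type u} [∀ i, AddCommGroup (M i)] {i n : ℤ} (h : i = n) : M i →+ M n :=
  h ▸ AddMonoidHom.id (M i)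

theorem castHom_castHom {M : ℤ → Type u} [∀ i, AddCommGroup (M i)] {i j n : ℤ} (h : i = j)
    (h' : j = n) (x : M i) : castHom h' (castHom h x) = castHom (h.trans h') x := by
  subst h h'
  rfl

theorem map_castHom {M N : ℤ → Type u} [∀ i, AddCommGroup (M i)] [∀ i, AddCommGroup (N i)]
    (f : ∀ i, M i →+ N i) {i n : ℤ} (h : i = n) (x : M i) :
    f n (castHom h x) = castHom h (f i x) := by
  subst h
  rfl

/-- The action of an integer on a graded abelian group. -/
def intSmul {M : ℤ → Type u} [∀ i, AddCommGroup (M i)] {i j n : ℤ} (h : i + j = n) (x : M i)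
    (a : intPart.{u} j) : M n :=
  -- For `j ≠ 0` the component `intPart j` is zero, so the default value loses nothing.
  if hj : j = 0 then a.1.down • castHom (by omega) x else 0

/-- The action of the integers on a graded abelian group. -/
def intAct {M : ℤ → Type u} [∀ i, AddCommGroup (M i)] {i j n : ℤ} (h : i + j = n) :
    M i →+ intPart.{u} j →+ M n :=
  AddMonoidHom.mk' (fun x => AddMonoidHom.mk' (intSmul h x) fun a b => by
        unfold intSmul
        split_ifs
        · exact add_smul _ _ _
        · rw [add_zero])
    fun x y => AddMonoidHom.ext fun a => by
      change intSmul h (x + y) a = intSmul h x a + intSmul h y a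
      unfold intSmul
      split_ifs
      · rw [map_add, smul_add]
      · rw [add_zero]

theorem intAct_zero {M : ℤ → Type u} [∀ i, AddCommGroup (M i)] {i n : ℤ} (h : i + 0 = n) (x : M i)
    (a : intPart.{u} 0) : intAct h x a = a.1.down • castHom (h ▸ (add_zero i).symm) x := by
  change intSmul h x a = _
  unfold intSmul
  rw [dif_pos rfl]

theorem intAct_of_ne {M : ℤ → Type u} [∀ i, AddCommGroup (M i)] {i j n : ℤ} (hj : j ≠ 0)
    (h : i + j = n) (x : M i) (a : intPart.{u} j) : intAct h x a = 0 :=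
  dif_neg hj

theorem intGr_act_zero (M : GrMod intGr.{u}) {i n : ℤ} (h : i + 0 = n) (x : M.carrier i)
    (a : intPart.{u} 0) : M.act h x a = a.1.down • castHom (h ▸ (add_zero i).symm) x := by
  obtain rfl : i = n := by omega
  -- Every scalar of degree zero is a multiple of the unit, so additivity and the unit law force the
  -- action.
  have : a = a.1.down • intGr.one := by
    refine Subtype.ext (ULift.ext _ _ ?_)
    change a.1.down = a.1.down • (1 : ℤ)
    simp
  conv_lhs => rw [this]
  refine (map_zsmul (M.act h x) _ _).trans ?_
  rw [M.act_one]
  rfl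

theorem intGr_act_of_ne (M : GrMod intGr.{u}) {i j n : ℤ} (hj : j ≠ 0) (h : i + j = n)
    (x : M.carrier i) (a : intPart.{u} j) : M.act h x a = 0 := by
  obtain rfl : a = 0 := Subtype.ext (a.2 hj)
  exact map_zero (M.act h x)

theorem intAct_intAct {M : ℤ → Type u} [∀ i, AddCommGroup (M i)] {i j m ij jm n : ℤ}
    (hij : i + j = ij) (hn : ij + m = n) (hjm : j + m = jm) (hn' : i + jm = n) (x : M i)
    (a : intPart.{u} j) (b : intPart.{u} m) :
    intAct hn (intAct hij x a) b = intAct hn' x (intMul hjm a b) := by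
  by_cases hj : j = 0
  · subst hj
    by_cases hm : m = 0
    · subst hm
      obtain rfl : jm = 0 := by omega
      rw [intAct_zero, intAct_zero, intAct_zero, map_zsmul, castHom_castHom, smul_smul, mul_comm]
      rfl
    · rw [intAct_of_ne hm, intAct_of_ne (by omega)]
  · obtain rfl : a = 0 := Subtype.ext (a.2 hj)
    rw [map_zero, map_zero]
    refine (AddMonoidHom.zero_apply b).trans ((map_zero (intAct hn' x)).symm.trans ?_)
    exact congrArg (intAct hn' x) (by rw [map_zero (intMul hjm)]; rfl)

theorem map_intAct {M N : ℤ → Type u} [∀ i, AddCommGroup (M i)] [∀ i, AddCommGroup (N i)]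
    (f : ∀ i, M i →+ N i) {i j n : ℤ} (h : i + j = n) (x : M i) (a : intPart.{u} j) :
    f n (intAct h x a) = intAct h (f i x) a := by
  by_cases hj : j = 0
  · subst hj
    rw [intAct_zero, intAct_zero, map_zsmul, map_castHom]
  · rw [intAct_of_ne hj, intAct_of_ne hj, map_zero]

/-- Graded abelian groups as graded modules over the integers. -/
def grAbToMod : GradedObject ℤ AddCommGrpCat.{u} ⥤ GrMod intGr.{u} where
  obj M :=
    { carrier i := M i
      act := intAct (M := fun i => M i)
      act_one h x := by
        refine (intAct_zero (M := fun i => M i) h x intGr.one).trans ?_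
        exact one_zsmul x
      act_mul := intAct_intAct (M := fun i => M i) }
  map {M N} f :=
    { app n := (f n).hom
      map_act h x a := map_intAct (M := fun i => M i) (N := fun i => N i)
        (fun i => (f i).hom) h x a }

/-- A graded module over the integers is determined by its underlying graded abelian group. -/
def modIso (M : GrMod intGr.{u}) : grAbToMod.obj ((GrMod.toGrAb _).obj M) ≅ M :=
  have key {i j n : ℤ} (h : i + j = n) (x : M.carrier i) (a : intPart.{u} j) :
      intAct h x a = M.act h x a := by
    by_cases hj : j = 0
    · subst hj
      rw [intAct_zero, intGr_act_zero]
    · rw [intAct_of_ne hj, intGr_act_of_ne M hj]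
  { hom := { app n := AddMonoidHom.id (M.carrier n), map_act := key }
    inv := { app n := AddMonoidHom.id (M.carrier n), map_act h x a := (key h x a).symm } }

section

variable (k : GrCommRing.{u})

/-- Commutative formal group schemes as formal `ℤ`-module schemes. -/
def FGrpSch.toFModSch : FGrpSch k ⥤ FModSch k intGr.{u} :=
  ObjectProperty.lift _ (ObjectProperty.ι _ ⋙ (Functor.whiskeringRight _ _ _).obj grAbToMod)
    fun F => F.property

instance : (FGrpSch.toFModSch k).Faithful where
  map_injective {A B f g} h := by
    refine ObjectProperty.hom_ext _ (NatTrans.ext (funext fun R => funext fun n => ?_))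
    ext x
    exact congrArg (fun t => (t.hom.app R).app n x) h

instance : (FGrpSch.toFModSch k).Full where
  map_surjective {A B} f := ⟨ObjectProperty.homMk {
    app R n := AddCommGrpCat.ofHom ((f.hom.app R).app n)
    naturality R S h := funext fun n => by
      ext x
      exact naturality_app f.hom h n x }, rfl⟩

instance : (FGrpSch.toFModSch k).EssSurj where
  mem_essImage M := ⟨(FModSch.res k _).obj M, ⟨ObjectProperty.isoMk _
    (NatIso.ofComponents (fun R => modIso (M.obj.obj R)) fun f => rfl)⟩⟩

instance : (FGrpSch.toFModSch k).IsEquivalence where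

instance : HasLimitsOfSize.{u, u} (FGrpSch k) :=
  ⟨fun _ _ => Adjunction.hasLimitsOfShape_of_equivalence (FGrpSch.toFModSch k)⟩

instance : HasColimitsOfSize.{u, u} (FGrpSch k) :=
  ⟨fun _ _ => Adjunction.hasColimitsOfShape_of_equivalence (FGrpSch.toFModSch k)⟩

/-- The passage to modules over the integers leaves the underlying sets unchanged, so the forgetful
functor is by definition the composite of an equivalence with the module case. -/
instance : (FGrpSch.forget k).IsRightAdjoint :=
  inferInstanceAs (FGrpSch.toFModSch k ⋙ FModSch.forget k intGr).IsRightAdjoint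

instance : (FGrpSch.forget k).ReflectsIsomorphisms :=
  inferInstanceAs (FGrpSch.toFModSch k ⋙ FModSch.forget k intGr).ReflectsIsomorphisms

end

section

universe v w₁ w₂ w₃

variable {C : Type w₁} {D : Type w₂} {D' : Type w₃} [Category.{v} C] [Category.{v} D]
  [Category.{v} D'] (J : D ⥤ D')
  [J.IsEquivalence] (R : D' ⥤ C)

/-- Splitness is a condition on the image under the whole composite, so `J` sends such pairs to
pairs split by `R`; an equivalence then reflects the existence of the coequalizer. -/
theorem hasCoequalizerOfIsSplitPair_comp [Monad.HasCoequalizerOfIsSplitPair R] :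
    Monad.HasCoequalizerOfIsSplitPair (J ⋙ R) where
  out f g h := by
    have : R.IsSplitPair (J.map f) (J.map g) := h
    have : HasColimit (parallelPair ((parallelPair f g ⋙ J).map WalkingParallelPairHom.left)
        ((parallelPair f g ⋙ J).map WalkingParallelPairHom.right)) :=
      Monad.HasCoequalizerOfIsSplitPair.out R (J.map f) (J.map g)
    have : HasColimit (parallelPair f g ⋙ J) :=
      hasColimit_of_iso (diagramIsoParallelPair (parallelPair f g ⋙ J))
    exact Adjunction.hasColimit_of_comp_equivalence _ J

theorem preservesColimitOfIsSplitPair_comp [Monad.PreservesColimitOfIsSplitPair R] :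
    Monad.PreservesColimitOfIsSplitPair (J ⋙ R) where
  out f g h := by
    have : R.IsSplitPair (J.map f) (J.map g) := h
    have : PreservesColimit (parallelPair ((parallelPair f g ⋙ J).map WalkingParallelPairHom.left)
        ((parallelPair f g ⋙ J).map WalkingParallelPairHom.right)) R :=
      Monad.PreservesColimitOfIsSplitPair.out (J.map f) (J.map g)
    have : PreservesColimit (parallelPair f g ⋙ J) R :=
      preservesColimit_of_iso_diagram R (diagramIsoParallelPair (parallelPair f g ⋙ J)).symm
    infer_instance

end

theorem FGrpSch.isEquivalence_comparison {k : GrCommRing.{u}} {L : FSch k ⥤ FGrpSch k}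
    (adj : L ⊣ FGrpSch.forget k) : (Monad.comparison adj).IsEquivalence :=
  have h₁ := hasCoequalizerOfIsSplitPair_comp (FGrpSch.toFModSch k) (FModSch.forget k intGr)
  have h₂ := preservesColimitOfIsSplitPair_comp (FGrpSch.toFModSch k) (FModSch.forget k intGr)
  have : Monad.HasCoequalizerOfIsSplitPair (FGrpSch.forget k) := h₁
  have : Monad.PreservesColimitOfIsSplitPair (FGrpSch.forget k) := h₂
  (Monad.monadicOfHasPreservesGSplitCoequalizersOfReflectsIsomorphisms adj).eqv

/-! ### Group objects described by generalized elements. -/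

section Dense

variable {C D : Type (u + 1)} [Category.{u} C] [Category.{u} D]

/-- Morphisms of `D` are determined by, and can be constructed from, their effect on generalized
elements with domains in the image of `K`. -/
structure IsDenseFamily (K : C ⥤ Dᵒᵖ) : Prop where
  hom_ext : ∀ {A B : D} {f g : A ⟶ B}, (∀ R (x : (K.obj R).unop ⟶ A), x ≫ f = x ≫ g) → f = g
  exists_hom : ∀ {A B : D} (θ : ∀ R, ((K.obj R).unop ⟶ A) → ((K.obj R).unop ⟶ B)),
    (∀ {R S} (g : R ⟶ S) (x : (K.obj R).unop ⟶ A),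
      θ S ((K.map g).unop ≫ x) = (K.map g).unop ≫ θ R x) → ∃ f : A ⟶ B, ∀ R x, x ≫ f = θ R x

namespace IsDenseFamily

variable {K : C ⥤ Dᵒᵖ} (hK : IsDenseFamily K)

/-- The morphism with a given effect on generalized elements. -/
noncomputable def hom {A B : D} (θ : ∀ R, ((K.obj R).unop ⟶ A) → ((K.obj R).unop ⟶ B))
    (h : ∀ {R S} (g : R ⟶ S) (x : (K.obj R).unop ⟶ A),
      θ S ((K.map g).unop ≫ x) = (K.map g).unop ≫ θ R x) : A ⟶ B :=
  (hK.exists_hom θ h).choose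

theorem comp_hom {A B : D} (θ : ∀ R, ((K.obj R).unop ⟶ A) → ((K.obj R).unop ⟶ B))
    (h : ∀ {R S} (g : R ⟶ S) (x : (K.obj R).unop ⟶ A),
      θ S ((K.map g).unop ≫ x) = (K.map g).unop ≫ θ R x) {R : C} (x : (K.obj R).unop ⟶ A) :
    x ≫ hK.hom θ h = θ R x :=
  (hK.exists_hom θ h).choose_spec R x

end IsDenseFamily

theorem symm_map_of_natural {K : C ⥤ Dᵒᵖ} {X : D} {G : C ⥤ AddCommGrpCat.{u}}
    (e : ∀ R, ((K.obj R).unop ⟶ X) ≃ G.obj R)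
    (he : ∀ {R S} (g : R ⟶ S) (x : (K.obj R).unop ⟶ X),
      e S ((K.map g).unop ≫ x) = G.map g (e R x)) {R S : C} (g : R ⟶ S) (y : G.obj R) :
    (e S).symm (G.map g y) = (K.map g).unop ≫ (e R).symm y := by
  rw [Equiv.symm_apply_eq, he, Equiv.apply_symm_apply]

open MonoidalCategory CartesianMonoidalCategory MonObj

variable [CartesianMonoidalCategory D] [BraidedCategory D]

/-- The functor `R ↦ Hom(K R, H)` to abelian groups. -/
def groupPoints (K : C ⥤ Dᵒᵖ) : CommGrp D ⥤ C ⥤ AddCommGrpCat.{u} :=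
  yonedaAb ⋙ (Functor.whiskeringLeft _ _ _).obj K

/-- A generalized element of `G ⊗ G` is a pair of elements of `G`, so compatibility with
multiplication, tested on such elements, is additivity of `θ`. -/
theorem isMonHom_of_groupPoints {K : C ⥤ Dᵒᵖ} (hK : IsDenseFamily K) {G H : CommGrp D}
    (θ : (groupPoints K).obj G ⟶ (groupPoints K).obj H) (f : G.X ⟶ H.X)
    (hf : ∀ R (x : (K.obj R).unop ⟶ G.X), x ≫ f = θ.app R x) : IsMonHom f where
  one_hom := hK.hom_ext fun R x => by
    have h₁ : x ≫ η[G.X] = 1 := by rw [Hom.one_def]; congr 1; exact toUnit_unique _ _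
    have h₂ : x ≫ η[H.X] = 1 := by rw [Hom.one_def]; congr 1; exact toUnit_unique _ _
    rw [← Category.assoc, h₁, h₂, hf]
    exact map_zero (θ.app R).hom
  mul_hom := hK.hom_ext fun R x => by
    have h₁ : x ≫ μ[G.X] = (x ≫ fst _ _) * (x ≫ snd _ _) := by
      rw [Hom.mul_def, ← comp_lift, lift_fst_snd, Category.comp_id]
    have h₂ : x ≫ (f ⊗ₘ f) ≫ μ[H.X] = (x ≫ fst _ _ ≫ f) * (x ≫ snd _ _ ≫ f) := by
      rw [Hom.mul_def, ← comp_lift, Category.assoc]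
      congr 2
      ext <;> simp
    rw [← Category.assoc, h₁, h₂, hf, ← Category.assoc, ← Category.assoc, hf, hf]
    exact map_add (θ.app R).hom (Additive.ofMul (x ≫ fst _ _)) (Additive.ofMul (x ≫ snd _ _))

theorem groupPoints_full {K : C ⥤ Dᵒᵖ} (hK : IsDenseFamily K) : (groupPoints K).Full where
  map_surjective {G H} θ := by
    obtain ⟨f, hf⟩ := hK.exists_hom (A := G.X) (B := H.X) (fun R x => θ.app R x)
      fun g x => congrArg (fun t => t.hom x) (θ.naturality g)
    have := isMonHom_of_groupPoints hK θ f hf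
    refine ⟨InducedCategory.homMk (Grp.homMk f), NatTrans.ext (funext fun R => ?_)⟩
    ext x
    exact hf R x

theorem groupPoints_faithful {K : C ⥤ Dᵒᵖ} (hK : IsDenseFamily K) : (groupPoints K).Faithful where
  map_injective {G H f g} h := CommGrp.hom_ext _ _ (hK.hom_ext fun R x =>
    congrArg (fun t => (t.app R).hom x) h)

section Represent

variable {K : C ⥤ Dᵒᵖ} (hK : IsDenseFamily K) {X : D} {G : C ⥤ AddCommGrpCat.{u}}
  (e : ∀ R, ((K.obj R).unop ⟶ X) ≃ G.obj R)

theorem mul_natural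
    (he : ∀ {R S} (g : R ⟶ S) (x : (K.obj R).unop ⟶ X),
      e S ((K.map g).unop ≫ x) = G.map g (e R x)) {R S : C} (g : R ⟶ S)
    (x : (K.obj R).unop ⟶ X ⊗ X) :
    (e S).symm (e S (((K.map g).unop ≫ x) ≫ fst _ _) + e S (((K.map g).unop ≫ x) ≫ snd _ _)) =
      (K.map g).unop ≫ (e R).symm (e R (x ≫ fst _ _) + e R (x ≫ snd _ _)) := by
  rw [Category.assoc, Category.assoc, he, he, ← map_add, symm_map_of_natural e he]

/-- The multiplication of an object that represents a functor to abelian groups. -/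
noncomputable def IsDenseFamily.mulHom
    (he : ∀ {R S} (g : R ⟶ S) (x : (K.obj R).unop ⟶ X),
      e S ((K.map g).unop ≫ x) = G.map g (e R x)) : X ⊗ X ⟶ X :=
  hK.hom (fun R x => (e R).symm (e R (x ≫ fst _ _) + e R (x ≫ snd _ _)))
    (mul_natural e he)

theorem IsDenseFamily.comp_mulHom
    (he : ∀ {R S} (g : R ⟶ S) (x : (K.obj R).unop ⟶ X),
      e S ((K.map g).unop ≫ x) = G.map g (e R x)) {R : C} (x : (K.obj R).unop ⟶ X ⊗ X) :
    x ≫ hK.mulHom e he = (e R).symm (e R (x ≫ fst _ _) + e R (x ≫ snd _ _)) :=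
  hK.comp_hom _ (mul_natural e he) x

/-- An object that represents a functor to abelian groups on the image of a dense family is a
commutative group object. -/
noncomputable def IsDenseFamily.commGrp
    (he : ∀ {R S} (g : R ⟶ S) (x : (K.obj R).unop ⟶ X),
      e S ((K.map g).unop ≫ x) = G.map g (e R x)) : CommGrp D :=
  have he' {R S} (g : R ⟶ S) (y : G.obj R) := symm_map_of_natural e he g y
  let m : X ⊗ X ⟶ X := hK.mulHom e he
  let o : 𝟙_ D ⟶ X := hK.hom (fun R x => (e R).symm 0) fun {R S} g x =>
    (congrArg (e S).symm (map_zero (G.map g).hom).symm).trans (he' g 0)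
  let i : X ⟶ X := hK.hom (fun R x => (e R).symm (- e R x)) fun {R S} g x => by
    rw [he, ← map_neg, he']
  have hm {R} (x : (K.obj R).unop ⟶ X ⊗ X) :
    x ≫ m = (e R).symm (e R (x ≫ fst _ _) + e R (x ≫ snd _ _)) := hK.comp_mulHom e he x
  have ho {R} (x : (K.obj R).unop ⟶ 𝟙_ D) : x ≫ o = (e R).symm 0 := hK.comp_hom _ _ x
  have hi {R} (x : (K.obj R).unop ⟶ X) : x ≫ i = (e R).symm (- e R x) := hK.comp_hom _ _ x
  have hm' {R} {Z : D} (x : (K.obj R).unop ⟶ Z) (y : Z ⟶ X ⊗ X) :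
    x ≫ y ≫ m = (e R).symm (e R (x ≫ y ≫ fst _ _) + e R (x ≫ y ≫ snd _ _)) := by
      rw [← Category.assoc, hm, Category.assoc, Category.assoc]
  have ho' {R} {Z : D} (x : (K.obj R).unop ⟶ Z) (y : Z ⟶ 𝟙_ D) :
    x ≫ y ≫ o = (e R).symm 0 := by rw [← Category.assoc, ho]
  -- Each axiom is an equality of morphisms and is tested on elements from the dense family, where
  -- `e` turns it into the corresponding identity in the abelian group `G R`.
  letI : GrpObj X :=
    { one := o
      mul := m
      inv := i
      one_mul := hK.hom_ext fun R x => by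
        rw [hm']
        simp [ho', leftUnitor_hom]
      mul_one := hK.hom_ext fun R x => by
        rw [hm']
        simp [ho', rightUnitor_hom]
      mul_assoc := hK.hom_ext fun R x => by
        have h := hm' (x ≫ (α_ X X X).hom) (X ◁ m)
        rw [Category.assoc] at h
        rw [hm', h]
        simp [hm', add_assoc]
      left_inv := hK.hom_ext fun R x => by
        rw [hm', ho']
        simp [hi]
      right_inv := hK.hom_ext fun R x => by
        rw [hm', ho']
        simp [hi] }
  haveI : IsCommMonObj X := ⟨hK.hom_ext fun R x => by
    change x ≫ _ ≫ m = x ≫ m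
    rw [← Category.assoc, hm, hm]
    simp [add_comm]⟩
  ⟨X⟩

theorem IsDenseFamily.exists_commGrp {K : C ⥤ Dᵒᵖ} (hK : IsDenseFamily K) {X : D}
    {G : C ⥤ AddCommGrpCat.{u}} (e : ∀ R, ((K.obj R).unop ⟶ X) ≃ G.obj R)
    (he : ∀ {R S} (g : R ⟶ S) (x : (K.obj R).unop ⟶ X),
      e S ((K.map g).unop ≫ x) = G.map g (e R x)) :
    ∃ H : CommGrp D, Nonempty ((groupPoints K).obj H ≅ G) := by
  refine ⟨hK.commGrp e he, ⟨NatIso.ofComponents (fun R => AddEquiv.toAddCommGrpIso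
    (X := ((groupPoints K).obj (hK.commGrp e he)).obj R) (Y := G.obj R)
    { e R with
      map_add' := fun x y => ?_ }) fun {R S} g => ?_⟩⟩
  · refine (congrArg (e R)
      (hK.comp_mulHom e he (lift (Additive.toMul x) (Additive.toMul y)))).trans ?_
    rw [Equiv.apply_symm_apply, lift_fst, lift_snd]
    rfl
  · ext x
    exact he g x

end Represent

end Dense

/-! ### Representable ind-objects are dense. -/

section Ind

variable {E : Type (u + 1)} [Category.{u} E]

/-- The Yoneda lemma for ind-objects. -/
noncomputable def indYonedaEquiv (R : E) (X : Ind E) :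
    (Ind.yoneda.obj R ⟶ X) ≃ ((Ind.inclusion E).obj X).obj (op R) :=
  (Ind.inclusion.fullyFaithful (C := E)).homEquiv.trans <|
    (Iso.homFromEquiv (Ind.yonedaCompInclusion.app R)).trans yonedaEquiv

theorem indYonedaEquiv_comp {R : E} {X Y : Ind E} (a : Ind.yoneda.obj R ⟶ X) (f : X ⟶ Y) :
    indYonedaEquiv R Y (a ≫ f) = ((Ind.inclusion E).map f).app (op R) (indYonedaEquiv R X a) := by
  change yonedaEquiv (Ind.yonedaCompInclusion.inv.app R ≫ (Ind.inclusion E).map (a ≫ f)) = _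
  rw [Functor.map_comp, ← Category.assoc]
  exact yonedaEquiv_comp _ _

theorem indYonedaEquiv_map {R S : E} {X : Ind E} (g : S ⟶ R) (a : Ind.yoneda.obj R ⟶ X) :
    indYonedaEquiv S X (Ind.yoneda.map g ≫ a) =
      ((Ind.inclusion E).obj X).map g.op (indYonedaEquiv R X a) := by
  change yonedaEquiv (Ind.yonedaCompInclusion.inv.app S ≫ (Ind.inclusion E).map _) =
    ((Ind.inclusion E).obj X).map g.op
      (yonedaEquiv (Ind.yonedaCompInclusion.inv.app R ≫ (Ind.inclusion E).map a))
  rw [yonedaEquiv_naturality, Functor.map_comp, ← Category.assoc, ← Category.assoc]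
  exact congrArg (fun h => yonedaEquiv (h ≫ (Ind.inclusion E).map a))
    (Ind.yonedaCompInclusion.inv.naturality g).symm

theorem indYonedaEquiv_symm_map {R S : E} {X : Ind E} (g : S ⟶ R)
    (a : ((Ind.inclusion E).obj X).obj (op R)) :
    (indYonedaEquiv S X).symm (((Ind.inclusion E).obj X).map g.op a) =
      Ind.yoneda.map g ≫ (indYonedaEquiv R X).symm a := by
  rw [Equiv.symm_apply_eq, indYonedaEquiv_map, Equiv.apply_symm_apply]

theorem Ind.hom_ext_of_yoneda {X Y : Ind E} {f g : X ⟶ Y}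
    (h : ∀ (R : E) (a : Ind.yoneda.obj R ⟶ X), a ≫ f = a ≫ g) : f = g := by
  refine (Ind.inclusion E).map_injective (NatTrans.ext (funext fun R => ?_))
  ext x
  have := congrArg (indYonedaEquiv _ _) (h R.unop ((indYonedaEquiv R.unop X).symm x))
  rw [indYonedaEquiv_comp, indYonedaEquiv_comp, Equiv.apply_symm_apply] at this
  exact this

/-- Values of the presheaf of an ind-object are its elements over representables, so a natural
operation on these elements is a map of presheaves; the inclusion is full. -/
theorem Ind.exists_hom_of_yoneda {X Y : Ind E}
    (θ : ∀ R : E, (Ind.yoneda.obj R ⟶ X) → (Ind.yoneda.obj R ⟶ Y))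
    (h : ∀ {R S : E} (g : S ⟶ R) (a : Ind.yoneda.obj R ⟶ X),
      θ S (Ind.yoneda.map g ≫ a) = Ind.yoneda.map g ≫ θ R a) :
    ∃ f : X ⟶ Y, ∀ (R : E) (a : Ind.yoneda.obj R ⟶ X), a ≫ f = θ R a := by
  let τ : (Ind.inclusion E).obj X ⟶ (Ind.inclusion E).obj Y :=
    { app R := TypeCat.ofHom fun x =>
        indYonedaEquiv R.unop Y (θ R.unop ((indYonedaEquiv R.unop X).symm x))
      naturality R S g := by
        ext x
        refine (congrArg (fun y => indYonedaEquiv S.unop Y (θ S.unop y))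
          (indYonedaEquiv_symm_map g.unop x)).trans ?_
        exact (congrArg (indYonedaEquiv S.unop Y) (h _ _)).trans (indYonedaEquiv_map _ _) }
  refine ⟨(Ind.inclusion E).preimage τ, fun R a => (indYonedaEquiv R Y).injective ?_⟩
  rw [indYonedaEquiv_comp, Functor.map_preimage]
  exact congrArg (fun y => indYonedaEquiv R Y (θ R y)) ((indYonedaEquiv R X).symm_apply_apply a)

theorem IsIndObject.exists_ind {P : Eᵒᵖ ⥤ Type u} (h : IsIndObject P) :
    ∃ X : Ind E, Nonempty ((Ind.inclusion E).obj X ≅ P) :=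
  ⟨(Ind.equivalence E).inverse.obj ⟨P, h⟩,
    ⟨(ObjectProperty.ι _).mapIso ((Ind.equivalence E).counitIso.app ⟨P, h⟩)⟩⟩

end Ind

/-! ### Formal spectra of pro-algebras and of Hopf pro-algebras. -/

section Points

variable (k : GrCommRing.{u})

/-- The constant pro-algebras, in the form in which they probe pro-algebras. -/
noncomputable abbrev probe : GrAlg k ⥤ (ProAlg k)ᵒᵖᵒᵖ := ProAlg.const k ⋙ opOp _

theorem isDenseFamily_probe : IsDenseFamily (probe k) where
  hom_ext {A B f g} h := by
    refine Quiver.Hom.unop_inj (Quiver.Hom.unop_inj (Ind.hom_ext_of_yoneda fun R a => ?_))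
    exact congrArg (fun t => t.unop.unop) (h R.unop a.op.op)
  exists_hom {A B} θ h := by
    obtain ⟨f, hf⟩ := Ind.exists_hom_of_yoneda (X := A.unop.unop) (Y := B.unop.unop)
      (fun R a => (θ R.unop a.op.op).unop.unop)
      fun g a => congrArg (fun t => t.unop.unop) (h g.unop a.op.op)
    exact ⟨f.op.op, fun R x => congrArg (fun t => t.op.op) (hf (op R) x.unop.unop)⟩

instance : (spfPoints k).Faithful where
  map_injective {A B f g} h := (isDenseFamily_probe k).hom_ext fun R x =>
    types_congr_hom (NatTrans.congr_app h R) x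

instance : (spfPoints k).Full where
  map_surjective {A B} θ := by
    obtain ⟨f, hf⟩ := (isDenseFamily_probe k).exists_hom (A := A) (B := B) (fun R x => θ.app R x)
      fun g x => types_congr_hom (θ.naturality g) x
    refine ⟨f, NatTrans.ext (funext fun R => ?_)⟩
    ext x
    exact hf R x

theorem exists_spfPoints_iso {F : GrAlg k ⥤ Type u} (h : IsIndRepresentable F) :
    ∃ A, Nonempty ((spfPoints k).obj A ≅ F) := by
  obtain ⟨X, ⟨i⟩⟩ := IsIndObject.exists_ind h
  refine ⟨op (op X), ⟨NatIso.ofComponents (fun R => Equiv.toIso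
    (((opEquiv _ (op (op X))).trans ((opEquiv _ _).trans (indYonedaEquiv (op R) X))).trans
      (i.app (op (op R))).toEquiv)) fun {R S} g => ?_⟩⟩
  ext x
  exact (congrArg (i.hom.app (op (op S))) (indYonedaEquiv_map g.op x.unop.unop)).trans
    (types_congr_hom (i.hom.naturality g.op.op) _)

instance : (spfGrpPoints k).Full := groupPoints_full (isDenseFamily_probe k)

instance : (spfGrpPoints k).Faithful := groupPoints_faithful (isDenseFamily_probe k)

/-- A pro-algebra that represents the underlying sets receives its cogroup structure from the group
structures on points, by density. -/
theorem exists_spfGrpPoints_iso {G : GrAlg k ⥤ AddCommGrpCat.{u}}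
    (h : IsIndRepresentable (G ⋙ CategoryTheory.forget AddCommGrpCat)) :
    ∃ H, Nonempty ((spfGrpPoints k).obj H ≅ G) := by
  obtain ⟨A, ⟨i⟩⟩ := exists_spfPoints_iso k h
  exact (isDenseFamily_probe k).exists_commGrp (X := A) (fun R => (i.app R).toEquiv)
    fun g x => types_congr_hom (i.hom.naturality g) x

end Points

/-! ### Formal spectra of graded families. -/

section Families

variable (k : GrCommRing.{u})

instance : (Spf k).Full where
  map_surjective {A B} θ := by
    let τ (q : ℤ) : (spfPoints k).obj (A q) ⟶ (spfPoints k).obj (B q) :=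
      { app R := θ.hom.app R q
        naturality R S g := congrFun (θ.hom.naturality g) q }
    refine ⟨fun q => (spfPoints k).preimage (τ q), ObjectProperty.hom_ext _
      (NatTrans.ext (funext fun R => funext fun q => ?_))⟩
    exact NatTrans.congr_app ((spfPoints k).map_preimage (τ q)) R

instance : (Spf k).Faithful where
  map_injective {A B f g} h := funext fun q => (spfPoints k).map_injective
    (NatTrans.ext (funext fun R => congrArg (fun t => t.hom.app R q) h))

instance : (SpfGrp k).Full where
  map_surjective {A B} θ := by
    let τ (q : ℤ) : (spfGrpPoints k).obj (A q) ⟶ (spfGrpPoints k).obj (B q) :=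
      { app R := θ.hom.app R q
        naturality R S g := congrFun (θ.hom.naturality g) q }
    refine ⟨fun q => (spfGrpPoints k).preimage (τ q), ObjectProperty.hom_ext _
      (NatTrans.ext (funext fun R => funext fun q => ?_))⟩
    exact NatTrans.congr_app ((spfGrpPoints k).map_preimage (τ q)) R

instance : (SpfGrp k).Faithful where
  map_injective {A B f g} h := funext fun q => (spfGrpPoints k).map_injective
    (NatTrans.ext (funext fun R => congrArg (fun t => t.hom.app R q) h))

instance : (SpfGrp k).EssSurj where
  mem_essImage G := by
    have h (q : ℤ) := exists_spfGrpPoints_iso k (G := G.obj ⋙ GradedObject.eval q) (G.property q)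
    choose H i using h
    refine ⟨H, ⟨ObjectProperty.isoMk _ (NatIso.ofComponents
      (fun R => Pi.isoMk fun q => (i q).some.app R) fun g => funext fun q => ?_)⟩⟩
    exact (i q).some.hom.naturality g

end Families

/-- The unit of the adjunction and `f` are both universal arrows from `c`, hence uniquely
isomorphic. -/
theorem isIso_homEquiv_symm_of_existsUnique {C D : Type*} [Category C] [Category D] {L : C ⥤ D}
    {G : D ⥤ C} (adj : L ⊣ G) {c : C} {d : D} (f : c ⟶ G.obj d)
    (h : ∀ (d' : D) (f' : c ⟶ G.obj d'), ∃! g : d ⟶ d', f ≫ G.map g = f') :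
    IsIso ((adj.homEquiv c d).symm f) := by
  obtain ⟨g, hg, -⟩ := h _ (adj.unit.app c)
  refine ⟨g, (adj.homEquiv _ _).injective ?_, (h _ f).unique ?_ ?_⟩
  · rw [adj.homEquiv_naturality_right, Equiv.apply_symm_apply, hg, adj.homEquiv_id]
  · rw [G.map_comp, ← Category.assoc]
    refine (congrArg (· ≫ _) hg).trans ?_
    rw [← adj.homEquiv_unit, Equiv.apply_symm_apply]
  · simp

/-! ### Cofree cocommutative Hopf pro-algebras. -/

section Cofree

variable (k : GrCommRing.{u})

/-- The free group scheme on the constant family `X` is `SpfGrp` of some family `H`. Its universal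
property concerns families, and the member `H 0` inherits one of its own. -/
theorem exists_free_commGrp {L : FSch k ⥤ FGrpSch k} (adj : L ⊣ FGrpSch.forget k)
    (X : (ProAlg k)ᵒᵖ) :
    ∃ (H : CommGrp (ProAlg k)ᵒᵖ) (η : X ⟶ (CommGrp.forget _).obj H), ∀ (K : CommGrp (ProAlg k)ᵒᵖ)
      (f : X ⟶ (CommGrp.forget _).obj K), ∃! g : H ⟶ K, η ≫ (CommGrp.forget _).map g = f := by
  let A : GradedObject ℤ (ProAlg k)ᵒᵖ := fun _ => X
  let H := (SpfGrp k).objPreimage (L.obj ((Spf k).obj A))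
  let i := (SpfGrp k).objObjPreimageIso (L.obj ((Spf k).obj A))
  let H' : GradedObject ℤ (ProAlg k)ᵒᵖ := fun q => (H q).X
  let η : A ⟶ H' := (Spf k).preimage (Y := H')
    (adj.unit.app ((Spf k).obj A) ≫ (FGrpSch.forget k).map i.inv)
  have hη : (Spf k).map η = adj.unit.app ((Spf k).obj A) ≫ (FGrpSch.forget k).map i.inv :=
    (Spf k).map_preimage _
  have key (K : GradedObject ℤ (CommGrp (ProAlg k)ᵒᵖ)) (f : ∀ q, X ⟶ (K q).X) :
      ∃! g : H ⟶ K, ∀ q, η q ≫ (CommGrp.forget _).map (g q) = f q := by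
    let f' : (Spf k).obj A ⟶ (FGrpSch.forget k).obj ((SpfGrp k).obj K) :=
      (Spf k).map (X := A) (Y := fun q => (K q).X) f
    have h (g : H ⟶ K) : (∀ q, η q ≫ (CommGrp.forget _).map (g q) = f q) ↔
        (adj.homEquiv _ _) (i.inv ≫ (SpfGrp k).map g) = f' := by
      let K' : GradedObject ℤ (ProAlg k)ᵒᵖ := fun q => (K q).X
      let g' : H' ⟶ K' := fun q => (CommGrp.forget _).map (g q)
      have e₁ : (adj.homEquiv _ _) (i.inv ≫ (SpfGrp k).map g) = (Spf k).map (η ≫ g') :=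
        (adj.homEquiv_unit ..).trans <|
          (congrArg (adj.unit.app ((Spf k).obj A) ≫ ·) ((FGrpSch.forget k).map_comp _ _)).trans <|
          (Category.assoc _ _ _).symm.trans <|
          (congrArg (· ≫ (FGrpSch.forget k).map ((SpfGrp k).map g)) hη.symm).trans
            ((Spf k).map_comp η g').symm
      rw [e₁]
      refine ⟨fun hg => congrArg (Spf k).map (funext hg), fun hg q =>
        congrFun ((Spf k).map_injective hg) q⟩
    refine ⟨(SpfGrp k).preimage (i.hom ≫ (adj.homEquiv _ _).symm f'), (h _).2 ?_, fun g hg => ?_⟩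
    · rw [Functor.map_preimage, Iso.inv_hom_id_assoc, Equiv.apply_symm_apply]
    · refine (SpfGrp k).map_injective ?_
      rw [Functor.map_preimage, ← (h g).1 hg, Equiv.symm_apply_apply, Iso.hom_inv_id_assoc]
  refine ⟨H 0, η 0, fun K f => ?_⟩
  obtain ⟨g, hg, hg'⟩ := key (fun _ => K) fun _ => f
  refine ⟨g 0, hg 0, fun t ht => ?_⟩
  -- Uniqueness is known only for families, so a competitor `t` in degree 0 is completed by `g` in
  -- the other degrees.
  have := hg' (Function.update g 0 t) fun q => by
    rcases eq_or_ne q 0 with rfl | hq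
    · rw [Function.update_self]
      exact ht
    · rw [Function.update_of_ne hq]
      exact hg q
  rw [← this, Function.update_self]

instance : (CommGrp.forget (ProAlg k)ᵒᵖ).IsRightAdjoint :=
  isRightAdjoint_of_exists_initial_arrow _
    (exists_free_commGrp k (Adjunction.ofIsRightAdjoint (FGrpSch.forget k)))

/-- The cofree cocommutative Hopf pro-algebra functor. -/
noncomputable def cofreeHopf : ProAlg k ⥤ HopfProAlg k :=
  (CommGrp.forget (ProAlg k)ᵒᵖ).leftAdjoint.rightOp

/-- The cofree cocommutative Hopf pro-algebra functor is right adjoint to the forgetful functor. -/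
noncomputable def cofreeHopfAdj : HopfProAlg.forget k ⊣ cofreeHopf k :=
  letI a := Adjunction.ofIsRightAdjoint (CommGrp.forget (ProAlg k)ᵒᵖ)
  { unit :=
      { app H := (a.counit.app H.unop).op
        naturality _ _ f := congrArg Quiver.Hom.op (a.counit.naturality f.unop).symm }
    counit :=
      { app A := (a.unit.app (op A)).unop
        naturality _ _ f := congrArg Quiver.Hom.unop (a.unit.naturality f.op).symm }
    left_triangle_components H := congrArg Quiver.Hom.unop (a.right_triangle_components H.unop)
    right_triangle_components A := congrArg Quiver.Hom.op (a.left_triangle_components (op A)) }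

end Cofree

theorem existsUnique_unit_comp {C D : Type*} [Category C] [Category D] {L : C ⥤ D} {G : D ⥤ C}
    (adj : L ⊣ G) {c : C} {d : D} (f : c ⟶ G.obj d) :
    ∃! g : L.obj c ⟶ d, adj.unit.app c ≫ G.map g = f := by
  refine ⟨(adj.homEquiv c d).symm f, ?_, fun g hg => ?_⟩
  · exact (adj.homEquiv_unit ..).symm.trans (Equiv.apply_symm_apply _ _)
  · rw [Equiv.eq_symm_apply, ← hg, adj.homEquiv_unit]

/-! ### Free formal group schemes as spectra of cofree Hopf pro-algebras. -/

section FreeGroup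

variable (k : GrCommRing.{u})

/-- The functor that sends a family of pro-algebras to the family of the cofree Hopf pro-algebras
on its members. -/
noncomputable abbrev cofreeFamily :
    GradedObject ℤ (ProAlg k)ᵒᵖ ⥤ GradedObject ℤ (CommGrp (ProAlg k)ᵒᵖ) :=
  Functor.pi fun _ => (cofreeHopf k).leftOp

/-- The formal spectrum of the counits of the cofree Hopf pro-algebras. -/
noncomputable def cofreeUnit : Spf k ⟶ (cofreeFamily k ⋙ SpfGrp k) ⋙ FGrpSch.forget k where
  app A := (Spf k).map (fun q => ((cofreeHopfAdj k).counit.app (A q).unop).op) ≫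
    (spfGrpForget k).inv.app (fun q => (cofreeHopf k).leftOp.obj (A q))
  naturality A B f := by
    let ε (A : GradedObject ℤ (ProAlg k)ᵒᵖ) (q : ℤ) :
        A q ⟶ (CommGrp.forget _).obj ((cofreeHopf k).leftOp.obj (A q)) :=
      ((cofreeHopfAdj k).counit.app (A q).unop).op
    have h (q : ℤ) : f q ≫ ε B q = ε A q ≫ (CommGrp.forget _).map ((cofreeFamily k).map f q) :=
      congrArg Quiver.Hom.op ((cofreeHopfAdj k).counit.naturality (f q).unop).symm
    refine FSch.hom_ext_app fun R q x => ?_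
    exact (Category.assoc x (f q) (ε B q)).trans
      ((congrArg (x ≫ ·) (h q)).trans (Category.assoc x (ε A q) _).symm)

/-- Up to isomorphism `G` is a formal spectrum, and `Spf` and `SpfGrp` are fully faithful, so the
claim is the universal property of the cofree Hopf pro-algebra in each degree separately. -/
theorem existsUnique_cofreeUnit_comp (A : GradedObject ℤ (ProAlg k)ᵒᵖ) (G : FGrpSch k)
    (f : (Spf k).obj A ⟶ (FGrpSch.forget k).obj G) :
    ∃! g : (SpfGrp k).obj ((cofreeFamily k).obj A) ⟶ G,
      (cofreeUnit k).app A ≫ (FGrpSch.forget k).map g = f := by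
  let H := (SpfGrp k).objPreimage G
  let i := (SpfGrp k).objObjPreimageIso G
  let H' : GradedObject ℤ (ProAlg k)ᵒᵖ := fun q => (H q).X
  let f' : (Spf k).obj A ⟶ (Spf k).obj H' := f ≫ (FGrpSch.forget k).map i.inv
  let ε (q : ℤ) : A q ⟶ (CommGrp.forget _).obj ((cofreeHopf k).leftOp.obj (A q)) :=
    ((cofreeHopfAdj k).counit.app (A q).unop).op
  have hε (q : ℤ) (t : A q ⟶ H' q) :
      ∃! s : (cofreeFamily k).obj A q ⟶ H q, ε q ≫ (CommGrp.forget _).map s = t :=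
    existsUnique_unit_comp (Adjunction.ofIsRightAdjoint (CommGrp.forget (ProAlg k)ᵒᵖ)) t
  have h (g : (cofreeFamily k).obj A ⟶ H) :
      (∀ q, ε q ≫ (CommGrp.forget _).map (g q) = (Spf k).preimage f' q) ↔
        (cofreeUnit k).app A ≫ (FGrpSch.forget k).map ((SpfGrp k).map g ≫ i.hom) = f := by
    let g' : (fun q => (CommGrp.forget _).obj ((cofreeHopf k).leftOp.obj (A q))) ⟶ H' :=
      fun q => (CommGrp.forget _).map (g q)
    have e : (cofreeUnit k).app A ≫ (FGrpSch.forget k).map ((SpfGrp k).map g ≫ i.hom) =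
        (Spf k).map (X := A) (Y := H') (ε ≫ g') ≫ (FGrpSch.forget k).map i.hom := by
      refine FSch.hom_ext_app fun R q x => ?_
      exact congrArg ((((FGrpSch.forget k).map i.hom).hom.app R) q)
        (Category.assoc x (ε q) (g' q))
    rw [e]
    have e' : (Spf k).map ((Spf k).preimage f') = f' := (Spf k).map_preimage f'
    have h₁ : (FGrpSch.forget k).map i.inv ≫ (FGrpSch.forget k).map i.hom = 𝟙 _ :=
      ((FGrpSch.forget k).mapIso i).inv_hom_id
    have h₂ : (FGrpSch.forget k).map i.hom ≫ (FGrpSch.forget k).map i.inv = 𝟙 _ :=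
      ((FGrpSch.forget k).mapIso i).hom_inv_id
    refine ⟨fun hg => ?_, fun hg q => ?_⟩
    · have e₁ : ε ≫ g' = (Spf k).preimage f' := funext hg
      refine (congrArg (· ≫ _) ((congrArg (Spf k).map e₁).trans e')).trans ?_
      exact (Category.assoc _ _ _).trans ((congrArg (f ≫ ·) h₁).trans (Category.comp_id f))
    · refine congrFun ((Spf k).map_injective (X := A) (Y := H') (a₁ := ε ≫ g') (Eq.trans ?_ e'.symm)) q
      refine Eq.trans ?_ (congrArg (· ≫ (FGrpSch.forget k).map i.inv) hg)
      refine (Category.comp_id _).symm.trans ?_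
      exact (congrArg (_ ≫ ·) h₂.symm).trans (Category.assoc _ _ _).symm
  choose s hs hs' using fun q => hε q ((Spf k).preimage f' q)
  refine ⟨(SpfGrp k).map s ≫ i.hom, (h s).1 hs, fun g hg => ?_⟩
  obtain ⟨g, rfl⟩ : ∃ g', g = (SpfGrp k).map g' ≫ i.hom :=
    ⟨(SpfGrp k).preimage (g ≫ i.inv), by simp⟩
  rw [funext fun q => hs' q (g q) ((h g).2 hg q)]

variable {k}

/-- The free formal group scheme on a formal spectrum is the formal spectrum of the cofree Hopf
pro-algebras. -/
noncomputable def freeSpfIso {L : FSch k ⥤ FGrpSch k} (adj : L ⊣ FGrpSch.forget k) :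
    Spf k ⋙ L ≅ cofreeFamily k ⋙ SpfGrp k :=
  haveI hi (A : GradedObject ℤ (ProAlg k)ᵒᵖ) :
      IsIso ((adj.homEquiv _ ((cofreeFamily k ⋙ SpfGrp k).obj A)).symm ((cofreeUnit k).app A)) :=
    isIso_homEquiv_symm_of_existsUnique adj _ (existsUnique_cofreeUnit_comp k A)
  NatIso.ofComponents
    (fun A => asIso ((adj.homEquiv _ ((cofreeFamily k ⋙ SpfGrp k).obj A)).symm
      ((cofreeUnit k).app A))) fun {A B} f => by
    refine (adj.homEquiv _ _).injective ?_
    refine (adj.homEquiv_naturality_left _ _).trans ?_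
    refine Eq.trans ?_ (adj.homEquiv_naturality_right _ _).symm
    simp only [asIso_hom, Equiv.apply_symm_apply]
    exact (cofreeUnit k).naturality f

theorem unit_comp_freeSpfIso {L : FSch k ⥤ FGrpSch k} (adj : L ⊣ FGrpSch.forget k)
    (A : GradedObject ℤ (ProAlg k)ᵒᵖ) :
    adj.unit.app ((Spf k).obj A) ≫ (FGrpSch.forget k).map ((freeSpfIso adj).hom.app A) =
      (cofreeUnit k).app A :=
  (adj.homEquiv_unit ..).symm.trans
    ((adj.homEquiv _ ((cofreeFamily k ⋙ SpfGrp k).obj A)).apply_symm_apply ((cofreeUnit k).app A))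

end FreeGroup

/-! ### Maps out of the objectwise free module, and the main theorem. -/

section Comparison

variable {k : GrCommRing.{u}} {l : GrRing.{u}}

theorem bijective_freeComparison_comp {L : FSch k ⥤ FModSch k l} (adj : L ⊣ FModSch.forget k l)
    (F : FSch k) (G : FModSch k l) :
    Function.Bijective (fun φ : L.obj F ⟶ G => freeComparison adj F ≫ φ.hom) := by
  -- Composition with the comparison map is passage to the adjunct map of sets `F ⟶ G`, followed by
  -- linear extension over each `R`. Both are bijective.
  have h (φ : L.obj F ⟶ G) (R : GrAlg k) : (freeComparison adj F ≫ φ.hom).app R =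
      ((GrMod.freeAdj l).homEquiv _ _).symm ((adj.homEquiv F G φ).hom.app R) := by
    refine Eq.trans ?_ ((GrMod.freeAdj l).homEquiv_counit ..).symm
    have e : (adj.homEquiv F G φ).hom.app R =
        (adj.unit.app F).hom.app R ≫ (GrMod.toGrSet l).map (φ.hom.app R) :=
      congrArg (fun t : F ⟶ _ => t.hom.app R) (adj.homEquiv_unit ..)
    refine Eq.trans ?_ (congrArg (fun t => (GrMod.free l).map t ≫ (GrMod.freeAdj l).counit.app _)
      e).symm
    refine Eq.trans ?_ (congrArg (· ≫ _) ((GrMod.free l).map_comp _ _)).symm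
    refine (Category.assoc _ _ _).trans (Eq.trans ?_ (Category.assoc _ _ _).symm)
    exact congrArg (_ ≫ ·) ((GrMod.freeAdj l).counit.naturality (φ.hom.app R)).symm
  refine ⟨fun φ ψ e => (adj.homEquiv F G).injective ?_, fun τ => ?_⟩
  · refine ObjectProperty.hom_ext _ (NatTrans.ext (funext fun R =>
      ((GrMod.freeAdj l).homEquiv _ _).symm.injective ?_))
    rw [← h, ← h]
    exact congrArg (fun t => t.app R) e
  · let σ : F ⟶ (FModSch.forget k l).obj G := ObjectProperty.homMk
      { app R := (GrMod.freeAdj l).homEquiv _ _ (τ.app R)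
        naturality R S g := ((GrMod.freeAdj l).homEquiv_naturality_left _ _).symm.trans <|
          (congrArg ((GrMod.freeAdj l).homEquiv _ _) (τ.naturality g)).trans <|
          (GrMod.freeAdj l).homEquiv_naturality_right _ _ }
    refine ⟨(adj.homEquiv F G).symm σ, NatTrans.ext (funext fun R => (h _ R).trans ?_)⟩
    rw [Equiv.apply_symm_apply]
    exact Equiv.symm_apply_apply _ _

end Comparison

theorem mainTheorem7 (k : GrCommRing.{u}) (l : GrRing.{u}) :
    (∃ (Γ : ProAlg k ⥤ HopfProAlg k) (adjΓ : HopfProAlg.forget k ⊣ Γ)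
      (Fr : FSch k ⥤ FGrpSch k) (adj : Fr ⊣ FGrpSch.forget k)
      (e : Spf k ⋙ Fr ≅ Functor.pi (fun _ : ℤ => Γ.leftOp) ⋙ SpfGrp k)
      (T : FGrpSch k ⥤ FModSch k l) (_ : T ⊣ FModSch.res k l)
      (Frl : FSch k ⥤ FModSch k l) (adjl : Frl ⊣ FModSch.forget k l),
      (∀ A : GradedObject ℤ (ProAlg k)ᵒᵖ,
        adj.unit.app ((Spf k).obj A) ≫ (FGrpSch.forget k).map (e.hom.app A) =
          (Spf k).map (fun q => (adjΓ.counit.app (A q).unop).op) ≫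
            (spfGrpForget k).inv.app (fun q => Γ.leftOp.obj (A q))) ∧
      (Monad.comparison adj).IsEquivalence ∧
      Nonempty (Fr ⋙ T ≅ Frl) ∧
      (∀ (F : FSch k) (G : FModSch k l),
        Function.Bijective (fun φ : Frl.obj F ⟶ G => freeComparison adjl F ≫ φ.hom)) ∧
      (Monad.comparison adjl).IsEquivalence) ∧
    HasLimitsOfSize.{u, u} (FGrpSch k) ∧ HasColimitsOfSize.{u, u} (FGrpSch k) ∧
    HasLimitsOfSize.{u, u} (FModSch k l) ∧ HasColimitsOfSize.{u, u} (FModSch k l) := by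
  let Fr := (FGrpSch.forget k).leftAdjoint
  let adj : Fr ⊣ FGrpSch.forget k := Adjunction.ofIsRightAdjoint _
  let adjT : (FModSch.res k l).leftAdjoint ⊣ FModSch.res k l := Adjunction.ofIsRightAdjoint _
  let adjl : (FModSch.forget k l).leftAdjoint ⊣ FModSch.forget k l := Adjunction.ofIsRightAdjoint _
  exact ⟨⟨cofreeHopf k, cofreeHopfAdj k, Fr, adj, freeSpfIso adj, _, adjT, _, adjl,
    unit_comp_freeSpfIso adj, FGrpSch.isEquivalence_comparison adj,
    -- The forgetful functor factors by definition through restriction to groups, so both sides are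
    -- left adjoints of the same functor.
    ⟨(adj.comp adjT).leftAdjointUniq adjl⟩, bijective_freeComparison_comp adjl,
    FModSch.isEquivalence_comparison adjl⟩,
    inferInstance, inferInstance, inferInstance, inferInstance⟩
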